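/- Let $\mathbf k$ be a commutative $\mathbb Q$-algebra, $Y=\{y_1>y_2>y_3>\cdots\}$ a totally ordered alphabet, $Y^*$ the set of words over $Y$ with the induced lexicographic order, and $\mathcal Lyn\,Y$ the set of Lyndon words (nonempty words strictly smaller than each of their proper nonempty suffixes). The quasi-shuffle (stuffle) product on $\mathbf k\langle Y\rangle$ is the bilinear product with $w\star 1=1\star w=w$ and $$y_iu\star y_jv=y_i(u\star y_jv)+y_j(y_iu\star v)+y_{i+j}(u\star v),$$ and $\Delta$ (that is, $\Delta_{\mathrm{stuffle}}$) is the coproduct on $\mathbf k\langle Y\rangle$ which is a morphism for concatenation and satisfies $\Delta y_n=y_n\otimes1+1\otimes y_n+\sum_{i=1}^{n-1}y_i\otimes y_{n-i}$. Words are orthonormal for the pairing $\langle\cdot|\cdot\rangle$ on $\mathbf k\langle Y\rangle$. Let $\mathbf{QSym}_{\mathbf k}$ be the algebra of quasi-symmetric functions: the free $\mathbf k$-module on the monomial functions $M_I$, $I$ a composition, with the commutative product obeying $M_\emptyset=1$ and the same recursion as the quasi-shuffle (with compositions in place of words). Let $\mathcal M:\mathbf k\langle Y\rangle\to\mathbf{QSym}_{\mathbf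 k}$ be the linear map $y_{i_1}\cdots y_{i_r}\mapsto M_{(i_1,\dots,i_r)}$, and $$\mathrm M=\sum_{w\in Y^*}\mathcal M(w)\,w\in\mathbf{QSym}_{\mathbf k}\langle\!\langle Y\rangle\!\rangle .$$ The product of noncommutative series is concatenation on words and the product of $\mathbf{QSym}_{\mathbf k}$ on coefficients, and $\Delta$ is extended to series by $\Delta S=\sum_w\langle S|w\rangle\,\Delta w$. Put $\pi_1(1)=0$ and, for a nonempty word $w$, $$\pi_1(w)=w+\sum_{r\ge2}\frac{(-1)^{r-1}}r\sum_{u_1,\dots,u_r\in Y^*\setminus\{1\}}\langle w\,|\,u_1\star\cdots\star u_r\rangle\,u_1\cdots u_r .$$ Define $\Pi_y=\pi_1(y)$ for $y\in Y$; $\Pi_l=[\Pi_s,\Pi_r]$ for a Lyndon word $l=sr$ of length at least $2$, where $r$ is its longest proper Lyndon suffix; and $\Pi_w=\Pi_{l_1}\cdots\Pi_{l_n}$ for $w=l_1\cdots l_n$ with Lyndon words $l_1\ge\cdots\ge l_n$. Then: 1. $\mathrm M$ is group-like: $\Delta \mathrm M=\mathrm M\,\hat\otimes\,\mathrm M$ and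 $\langle \mathrm M|1\rangle=1$. 2. $\log\mathrm M$ is primitive: $\Delta\log\mathrm M=\log\mathrm M\,\hat\otimes\,1+1\,\hat\otimes\log\mathrm M$. 3. There is exactly one family $(\Sigma_w)_{w\in Y^*}$ in $\mathbf k\langle Y\rangle$ dual to $(\Pi_w)$, i.e. with $\langle\Pi_u|\Sigma_v\rangle=\delta_{u,v}$ for all $u,v\in Y^*$, and $$\mathrm M=\prod_{l\in\mathcal Lyn\,Y}^{\searrow}\exp\bigl(\mathcal M(\Sigma_l)\,\Pi_l\bigr),$$ where the product is in decreasing order of $l$ from left to right and is the coefficientwise limit of the finite decreasing products. 4. $\displaystyle\log\mathrm M=\sum_{w\in Y^*}\mathcal M(w)\,\pi_1(w)$, a locally finite sum (for each word $v$, only finitely many $w$ contribute to the coefficient of $v$). -/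

import Mathlib

open scoped TensorProduct

noncomputable section

namespace Quasi

/-! ### Words over the alphabet `Y = {y_1 > y_2 > ...}`; the letter `y_n` is encoded by `n : ℕ+` -/

/-- Words over `Y`; equivalently, compositions of integers. -/
abbrev Word : Type := List ℕ+

/-- The weight of a word: the sum of the indices of its letters. -/
def weight (w : Word) : ℕ := (w.map (fun i : ℕ+ => (i : ℕ))).sum

/-- The lexicographic order on words induced by `y_1 > y_2 > y_3 > ...`. -/
def WordLT (u v : Word) : Prop := List.Lex (fun i j : ℕ+ => j < i) u v

/-- Lyndon words: nonempty words strictly smaller than all their proper nonempty suffixes. -/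
def IsLyndon (l : Word) : Prop :=
  l ≠ [] ∧ ∀ i, 0 < i → i < l.length → WordLT l (l.drop i)

theorem isLyndon_letter (a : ℕ+) : IsLyndon [a] :=
  ⟨by simp, fun i h0 h1 => by simp at h1; omega⟩

theorem exists_lyndon_suffix (l : Word) (h : 2 ≤ l.length) :
    ∃ i, 0 < i ∧ i < l.length ∧ IsLyndon (l.drop i) := by
  refine ⟨l.length - 1, by omega, by omega, ?_⟩
  have h1 : (l.drop (l.length - 1)).length = 1 := by rw [List.length_drop]; omega
  obtain ⟨a, ha⟩ := List.length_eq_one_iff.1 h1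
  rw [ha]; exact isLyndon_letter a

open Classical in
/-- The cutting position of the standard factorization `l = s r` of a word of length at least two:
`r` is the longest proper suffix of `l` that is a Lyndon word. -/
def stdCut (l : Word) (h : 2 ≤ l.length) : ℕ := Nat.find (exists_lyndon_suffix l h)

theorem stdCut_spec (l : Word) (h : 2 ≤ l.length) :
    0 < stdCut l h ∧ stdCut l h < l.length ∧ IsLyndon (l.drop (stdCut l h)) := by
  classical exact Nat.find_spec (exists_lyndon_suffix l h)

/-- `L` is a factorization of `w` as a nonincreasing product of Lyndon words. -/
def IsLyndonFactorization (L : List Word) (w : Word) : Prop :=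
  (∀ l ∈ L, IsLyndon l) ∧ L.Pairwise (fun l l' => ¬ WordLT l l') ∧ L.flatten = w

/-- The finite set of all words of weight at most `n`. -/
def wordsOfWeightLE (n : ℕ) : Finset Word :=
  (Finset.range (n + 1)).biUnion fun m =>
    (Finset.univ : Finset (Composition m)).image fun c =>
      c.blocks.map Nat.toPNat'

theorem mem_wordsOfWeightLE {n : ℕ} {w : Word} : w ∈ wordsOfWeightLE n ↔ weight w ≤ n := by
  simp only [wordsOfWeightLE, Finset.mem_biUnion, Finset.mem_range, Finset.mem_image,
    Finset.mem_univ, true_and]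
  constructor
  · rintro ⟨m, hm, c, rfl⟩
    have : weight (c.blocks.map Nat.toPNat') = m := by
      conv_rhs => rw [← c.blocks_sum]
      unfold weight
      rw [List.map_map]
      congr 1
      conv_rhs => rw [← List.map_id c.blocks]
      refine List.map_congr_left fun i hi => ?_
      have := c.blocks_pos hi
      simp only [Function.comp, Nat.toPNat'_coe, this, if_true, id]
    omega
  · intro h
    refine ⟨weight w, by omega, ⟨w.map (fun i : ℕ+ => (i : ℕ)), ?_, rfl⟩, ?_⟩
    · intro i hi
      obtain ⟨a, _, rfl⟩ := List.mem_map.1 hi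
      exact a.pos
    · simp [Function.comp_def]

/-! ### The quasi-shuffle product -/

section Stuffle

variable (k : Type*) [CommRing k]

/-- The quasi-shuffle (stuffle) of two words, as a linear combination of words. -/
def stuffle : Word → Word → (Word →₀ k)
  | [], w => Finsupp.single w 1
  | i :: u, [] => Finsupp.single (i :: u) 1
  | i :: u, j :: v =>
      (stuffle (i :: u) v).mapDomain (j :: ·) + (stuffle u (j :: v)).mapDomain (i :: ·)
        + (stuffle u v).mapDomain ((i + j) :: ·)
  termination_by u v => u.length + v.length

/-- The bilinear extension of the quasi-shuffle product. -/
def stuffleMul : (Word →₀ k) →ₗ[k] (Word →₀ k) →ₗ[k] (Word →₀ k) :=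
  Finsupp.lift _ k Word fun u => Finsupp.lift _ k Word fun v => stuffle k u v

variable {k}

theorem stuffleMul_single (u v : Word) :
    stuffleMul k (Finsupp.single u 1) (Finsupp.single v 1) = stuffle k u v := by
  simp [stuffleMul]

theorem stuffle_nil_right (u : Word) : stuffle k u [] = Finsupp.single u 1 := by
  cases u <;> rw [stuffle]

theorem stuffle_comm (u v : Word) : stuffle k u v = stuffle k v u := by
  induction u, v using stuffle.induct with
  | case1 w => rw [stuffle_nil_right, stuffle]
  | case2 i u => rw [stuffle_nil_right, stuffle]
  | case3 i u j v h1 h2 h3 =>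
    rw [stuffle, stuffle, h1, h2, h3, add_comm i j]
    abel

theorem stuffleMul_comm (x y : Word →₀ k) : stuffleMul k x y = stuffleMul k y x := by
  have : stuffleMul k = (stuffleMul k).flip := by
    ext u v : 4
    simp [LinearMap.flip_apply, stuffleMul_single, stuffle_comm]
  rw [this, LinearMap.flip_apply, ← this]

theorem one_stuffleMul (x : Word →₀ k) : stuffleMul k (Finsupp.single [] 1) x = x := by
  have : stuffleMul k (Finsupp.single [] 1) = LinearMap.id := by
    ext v : 2
    simp [stuffleMul_single, stuffle]
  rw [this, LinearMap.id_apply]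

/-- Prepending a letter, linearly. -/
def prepend (i : ℕ+) : (Word →₀ k) →ₗ[k] (Word →₀ k) := Finsupp.lmapDomain k k (i :: ·)

theorem prepend_single (i : ℕ+) (u : Word) (a : k) :
    prepend i (Finsupp.single u a) = Finsupp.single (i :: u) a := by
  simp [prepend]

theorem stuffleMul_prepend (i j : ℕ+) (x y : Word →₀ k) :
    stuffleMul k (prepend i x) (prepend j y) =
      prepend j (stuffleMul k (prepend i x) y) + prepend i (stuffleMul k x (prepend j y))
        + prepend (i + j) (stuffleMul k x y) := by
  induction x using Finsupp.induction_linear with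
  | zero => simp
  | add x x' hx hx' => simp only [map_add, LinearMap.add_apply, hx, hx']; abel
  | single u a =>
    induction y using Finsupp.induction_linear with
    | zero => simp
    | add y y' hy hy' => simp only [map_add, hy, hy']; abel
    | single v b =>
      have ha : Finsupp.single u a = a • Finsupp.single u (1 : k) := by simp
      have hb : Finsupp.single v b = b • Finsupp.single v (1 : k) := by simp
      rw [ha, hb]
      simp only [map_smul, LinearMap.smul_apply, prepend_single, stuffleMul_single]
      rw [stuffle]
      simp only [prepend, Finsupp.lmapDomain_apply, smul_add]

theorem stuffleMul_assoc_aux (a b c : ℕ+) (x y z : Word →₀ k)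
    (i1 : stuffleMul k (stuffleMul k x (prepend b y)) (prepend c z)
      = stuffleMul k x (stuffleMul k (prepend b y) (prepend c z)))
    (i2 : stuffleMul k (stuffleMul k (prepend a x) y) (prepend c z)
      = stuffleMul k (prepend a x) (stuffleMul k y (prepend c z)))
    (i3 : stuffleMul k (stuffleMul k (prepend a x) (prepend b y)) z
      = stuffleMul k (prepend a x) (stuffleMul k (prepend b y) z))
    (i4 : stuffleMul k (stuffleMul k x y) (prepend c z)
      = stuffleMul k x (stuffleMul k y (prepend c z)))
    (i5 : stuffleMul k (stuffleMul k x (prepend b y)) z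
      = stuffleMul k x (stuffleMul k (prepend b y) z))
    (i6 : stuffleMul k (stuffleMul k (prepend a x) y) z
      = stuffleMul k (prepend a x) (stuffleMul k y z))
    (i7 : stuffleMul k (stuffleMul k x y) z = stuffleMul k x (stuffleMul k y z)) :
    stuffleMul k (stuffleMul k (prepend a x) (prepend b y)) (prepend c z)
      = stuffleMul k (prepend a x) (stuffleMul k (prepend b y) (prepend c z)) := by
  have hL : stuffleMul k (stuffleMul k (prepend a x) (prepend b y)) (prepend c z)
      = prepend c (stuffleMul k (stuffleMul k (prepend a x) (prepend b y)) z)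
        + prepend b (stuffleMul k (stuffleMul k (prepend a x) y) (prepend c z))
        + prepend a (stuffleMul k (stuffleMul k x (prepend b y)) (prepend c z))
        + prepend (a + b) (stuffleMul k (stuffleMul k x y) (prepend c z))
        + prepend (b + c) (stuffleMul k (stuffleMul k (prepend a x) y) z)
        + prepend (a + c) (stuffleMul k (stuffleMul k x (prepend b y)) z)
        + prepend (a + b + c) (stuffleMul k (stuffleMul k x y) z) := by
    simp only [map_add, LinearMap.add_apply, stuffleMul_prepend]; abel
  have hR : stuffleMul k (prepend a x) (stuffleMul k (prepend b y) (prepend c z))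
      = prepend c (stuffleMul k (prepend a x) (stuffleMul k (prepend b y) z))
        + prepend b (stuffleMul k (prepend a x) (stuffleMul k y (prepend c z)))
        + prepend a (stuffleMul k x (stuffleMul k (prepend b y) (prepend c z)))
        + prepend (a + b) (stuffleMul k x (stuffleMul k y (prepend c z)))
        + prepend (b + c) (stuffleMul k (prepend a x) (stuffleMul k y z))
        + prepend (a + c) (stuffleMul k x (stuffleMul k (prepend b y) z))
        + prepend (a + b + c) (stuffleMul k x (stuffleMul k y z)) := by
    simp only [map_add, stuffleMul_prepend, add_assoc]; abel
  rw [hL, hR, i1, i2, i3, i4, i5, i6, i7]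

theorem stuffleMul_assoc_single (n : ℕ) : ∀ u v w : Word, u.length + v.length + w.length ≤ n →
    stuffleMul k (stuffleMul k (Finsupp.single u 1) (Finsupp.single v 1)) (Finsupp.single w 1) =
    stuffleMul k (Finsupp.single u 1)
      (stuffleMul k (Finsupp.single v 1) (Finsupp.single w 1)) := by
  induction n with
  | zero =>
    intro u v w h
    have : u = [] := List.length_eq_zero_iff.1 (by omega)
    subst this
    simp only [one_stuffleMul]
  | succ n ih =>
    intro u v w h
    rcases u with _ | ⟨a, u⟩
    · simp only [one_stuffleMul]
    rcases v with _ | ⟨b, v⟩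
    · rw [stuffleMul_comm (Finsupp.single (a :: u) 1)]; simp only [one_stuffleMul]
    rcases w with _ | ⟨c, w⟩
    · rw [stuffleMul_comm _ (Finsupp.single [] 1), stuffleMul_comm _ (Finsupp.single [] 1)]
      simp only [one_stuffleMul]
    simp only [List.length_cons] at h
    have i1 := ih u (b :: v) (c :: w) (by simp only [List.length_cons]; omega)
    have i2 := ih (a :: u) v (c :: w) (by simp only [List.length_cons]; omega)
    have i3 := ih (a :: u) (b :: v) w (by simp only [List.length_cons]; omega)
    have i4 := ih u v (c :: w) (by simp only [List.length_cons]; omega)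
    have i5 := ih u (b :: v) w (by simp only [List.length_cons]; omega)
    have i6 := ih (a :: u) v w (by simp only [List.length_cons]; omega)
    have i7 := ih u v w (by omega)
    simp only [← prepend_single] at i1 i2 i3 i4 i5 i6 ⊢
    exact stuffleMul_assoc_aux a b c _ _ _ i1 i2 i3 i4 i5 i6 i7

theorem stuffleMul_assoc (x y z : Word →₀ k) :
    stuffleMul k (stuffleMul k x y) z = stuffleMul k x (stuffleMul k y z) := by
  induction x using Finsupp.induction_linear with
  | zero => simp
  | add x x' hx hx' => simp only [map_add, LinearMap.add_apply, hx, hx']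
  | single u a =>
    induction y using Finsupp.induction_linear with
    | zero => simp
    | add y y' hy hy' => simp only [map_add, LinearMap.add_apply, hy, hy']
    | single v b =>
      induction z using Finsupp.induction_linear with
      | zero => simp
      | add z z' hz hz' => simp only [map_add, hz, hz']
      | single w c =>
        have ha : Finsupp.single u a = a • Finsupp.single u (1 : k) := by simp
        have hb : Finsupp.single v b = b • Finsupp.single v (1 : k) := by simp
        have hc : Finsupp.single w c = c • Finsupp.single w (1 : k) := by simp
        rw [ha, hb, hc]
        simp only [map_smul, LinearMap.smul_apply, stuffleMul_assoc_single _ u v w le_rfl]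

theorem smul_stuffleMul {S : Type*} [CommRing S] [Algebra S k] (r : S) (x y : Word →₀ k) :
    stuffleMul k (r • x) y = r • stuffleMul k x y := by
  rw [← algebraMap_smul k r x, map_smul, LinearMap.smul_apply, algebraMap_smul]

theorem stuffleMul_smul {S : Type*} [CommRing S] [Algebra S k] (r : S) (x y : Word →₀ k) :
    stuffleMul k x (r • y) = r • stuffleMul k x y := by
  rw [← algebraMap_smul k r y, map_smul, algebraMap_smul]

end Stuffle

/-! ### Quasi-symmetric functions -/

/-- The algebra of quasi-symmetric functions over `k`: the free module on the monomial
quasi-symmetric functions `M_I`, `I` a composition, with the commutative product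
`M_{iI} ⋆ M_{jJ} = M_i (M_I ⋆ M_{jJ}) + M_j (M_{iI} ⋆ M_J) + M_{i+j} (M_I ⋆ M_J)`. -/
def QSym (k : Type*) [CommRing k] : Type _ := Word →₀ k

namespace QSym

variable (k : Type*) [CommRing k]

instance : AddCommGroup (QSym k) := inferInstanceAs (AddCommGroup (Word →₀ k))

/-- The monomial quasi-symmetric function `M_I`. -/
def M (I : Word) : QSym k := (Finsupp.single I 1 : Word →₀ k)

instance : CommRing (QSym k) :=
  { (inferInstance : AddCommGroup (QSym k)) with
    mul := fun x y => stuffleMul k x y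
    one := M k []
    mul_assoc := fun x y z => stuffleMul_assoc x y z
    mul_comm := fun x y => stuffleMul_comm x y
    one_mul := fun x => one_stuffleMul x
    mul_one := fun x => (stuffleMul_comm x _).trans (one_stuffleMul x)
    left_distrib := fun x y z => map_add (stuffleMul k x) y z
    right_distrib := fun x y z => LinearMap.map_add₂ (stuffleMul k) x y z
    zero_mul := fun x => LinearMap.map_zero₂ (stuffleMul k) x
    mul_zero := fun x => map_zero (stuffleMul k x) }

variable {S : Type*} [CommRing S] [Algebra S k]

instance : Module S (QSym k) := inferInstanceAs (Module S (Word →₀ k))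

/-- Scalars act coefficientwise; both `k` and `ℚ` (when `k` is a `ℚ`-algebra) act. -/
instance : Algebra S (QSym k) :=
  Algebra.ofModule
    (fun r x y => smul_stuffleMul r x y) (fun r x y => stuffleMul_smul r x y)

end QSym

/-! ### Noncommutative polynomials -/

section Poly

variable (k : Type*) [CommRing k]

/-- `k⟨Y⟩`, with the concatenation product. -/
abbrev NCPoly : Type _ := MonoidAlgebra k (FreeMonoid ℕ+)

/-- A word, as a polynomial. -/
def word (w : Word) : NCPoly k := MonoidAlgebra.single (FreeMonoid.ofList w) 1

/-- The coefficient `⟨P | w⟩`. -/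
def coeffL (w : Word) : NCPoly k →ₗ[k] k :=
  Finsupp.lapply (FreeMonoid.ofList w) ∘ₗ (MonoidAlgebra.coeffLinearEquiv k).toLinearMap

/-- The pairing `⟨P | Q⟩ = ∑_w ⟨P | w⟩ ⟨Q | w⟩` for which words are orthonormal. -/
def pairing (P Q : NCPoly k) : k := P.coeff.sum fun w a => a * Q.coeff w

/-- The coefficient of `u ⊗ v`. -/
def coeffTensor (u v : Word) : NCPoly k ⊗[k] NCPoly k →ₗ[k] k :=
  LinearMap.mul' k k ∘ₗ TensorProduct.map (coeffL k u) (coeffL k v)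

/-- The value of `Δ_stuffle` on the letter `y_n`. -/
def coprodLetter (n : ℕ+) : NCPoly k ⊗[k] NCPoly k :=
  word k [n] ⊗ₜ 1 + 1 ⊗ₜ word k [n] + ∑ i ∈ Finset.Ico 1 n, word k [i] ⊗ₜ word k [n - i]

/-- The coproduct `Δ_stuffle`, the morphism for concatenation defined on letters by
`Δ y_n = y_n ⊗ 1 + 1 ⊗ y_n + ∑_{i=1}^{n-1} y_i ⊗ y_{n-i}`. -/
def coprod : NCPoly k →ₐ[k] NCPoly k ⊗[k] NCPoly k :=
  MonoidAlgebra.lift k (NCPoly k ⊗[k] NCPoly k) (FreeMonoid ℕ+) (FreeMonoid.lift (coprodLetter k))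

theorem coprod_word_mem (w : Word) : coprod k (word k w) ∈ Submodule.span k
    {t | ∃ u v : Word, weight u + weight v = weight w ∧ t = word k u ⊗ₜ[k] word k v} := by
  have hone : (1 : NCPoly k) = word k [] := rfl
  have hmul : ∀ u v : Word, word k u * word k v = word k (u ++ v) := fun u v => by
    simp [word, MonoidAlgebra.single_mul_single]
  induction w with
  | nil =>
    rw [← hone, map_one, Algebra.TensorProduct.one_def, hone]
    exact Submodule.subset_span ⟨[], [], rfl, rfl⟩
  | cons a w ih =>
    have hw : word k (a :: w) = word k [a] * word k w := by rw [hmul]; rfl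
    have hc : coprod k (word k [a]) = coprodLetter k a := by
      rw [coprod, word, MonoidAlgebra.lift_single, one_smul]
      exact FreeMonoid.lift_eval_of _ _
    have ha : coprodLetter k a ∈ Submodule.span k
        {t | ∃ u v : Word, weight u + weight v = weight [a] ∧ t = word k u ⊗ₜ[k] word k v} := by
      refine add_mem (add_mem ?_ ?_) (sum_mem fun i hi => ?_)
      · exact Submodule.subset_span ⟨[a], [], rfl, by rw [hone]⟩
      · exact Submodule.subset_span ⟨[], [a], by simp [weight], by rw [hone]⟩
      · refine Submodule.subset_span ⟨[i], [a - i], ?_, rfl⟩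
        have := (Finset.mem_Ico.1 hi).2
        have h2 := PNat.add_sub_of_lt this
        simp only [weight, List.map_cons, List.map_nil, List.sum_cons, List.sum_nil, add_zero]
        exact_mod_cast h2
    rw [hw, map_mul, hc]
    have := Submodule.mul_mem_mul ha ih
    rw [Submodule.span_mul_span] at this
    refine Submodule.span_mono ?_ this
    rintro _ ⟨_, ⟨u, v, h, rfl⟩, _, ⟨u', v', h', rfl⟩, rfl⟩
    refine ⟨u ++ u', v ++ v', ?_, ?_⟩
    · simp only [weight, List.map_append, List.sum_append, List.map_cons, List.map_nil,
        List.sum_cons, List.sum_nil, add_zero] at h h' ⊢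
      omega
    · simp only [Algebra.TensorProduct.tmul_mul_tmul, hmul]

/-- Local finiteness of the coproduct. -/
theorem finite_coprod_support (u v : Word) :
    {w | coeffTensor k u v (coprod k (word k w)) ≠ 0}.Finite := by
  refine (wordsOfWeightLE (weight u + weight v)).finite_toSet.subset fun w hw => ?_
  rw [Finset.mem_coe, mem_wordsOfWeightLE]
  by_contra hlt
  refine hw ?_
  have : Submodule.span k
      {t | ∃ u v : Word, weight u + weight v = weight w ∧ t = word k u ⊗ₜ[k] word k v} ≤
      LinearMap.ker (coeffTensor k u v) := by
    rw [Submodule.span_le]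
    rintro _ ⟨u', v', h, rfl⟩
    rw [SetLike.mem_coe, LinearMap.mem_ker]
    have hco : ∀ x y : Word, x ≠ y → coeffL k y (word k x) = 0 := fun x y hxy => by
      change (MonoidAlgebra.single (FreeMonoid.ofList x) (1 : k)).coeff (FreeMonoid.ofList y) = 0
      rw [MonoidAlgebra.coeff_single]
      exact Finsupp.single_eq_of_ne fun h => hxy (FreeMonoid.ofList.injective h).symm
    by_cases h1 : u' = u
    · have h2 : v' ≠ v := by rintro rfl; subst h1; omega
      simp [coeffTensor, hco _ _ h2]
    · simp [coeffTensor, hco _ _ h1]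
  exact this (coprod_word_mem k w)

/-- The linear map `k⟨Y⟩ → QSym_k`, `y_{i_1} ... y_{i_r} ↦ M_{(i_1, ..., i_r)}`. -/
def toQSym : NCPoly k →ₗ[k] QSym k :=
  (Finsupp.lift (QSym k) k (FreeMonoid ℕ+) fun w => QSym.M k w.toList) ∘ₗ
    (MonoidAlgebra.coeffLinearEquiv k).toLinearMap

/-- The quasi-shuffle product of a list of words. -/
def stuffleList (L : List Word) : Word →₀ k :=
  (L.map fun u => (Finsupp.single u 1 : Word →₀ k)).foldr (fun x y => stuffleMul k x y)
    (Finsupp.single [] 1)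

end Poly

section Basis

variable (k : Type*) [CommRing k] [Algebra ℚ k]

/-- `π₁(1) = 0` and, for `w ≠ 1`,
`π₁(w) = w + ∑_{r ≥ 2} (-1)^{r-1}/r ∑_{u_1, ..., u_r ≠ 1} ⟨w | u_1 ⋆ ... ⋆ u_r⟩ u_1 ... u_r`
(`⋆` the quasi-shuffle). The sum is restricted to `r ≤ weight w` and words `u_i` of weight at most
`weight w`, as the quasi-shuffle is homogeneous for the weight. -/
def piOne (w : Word) : NCPoly k :=
  if w = [] then 0
  else word k w + ∑ r ∈ Finset.Icc 2 (weight w),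
    ((-1 : ℚ) ^ (r - 1) / r) •
      ∑ u ∈ Fintype.piFinset fun _ : Fin r => (wordsOfWeightLE (weight w)).filter (· ≠ []),
        stuffleList k (List.ofFn u) w • word k (List.ofFn u).flatten

/-- `Π_l` for a Lyndon word `l`: `Π_y = π₁(y)` for a letter `y`, and `Π_l = [Π_s, Π_r]` for `l` with
standard factorization `(s, r)`. -/
def lyndonPi : Word → NCPoly k
  | [] => 0
  | [a] => piOne k [a]
  | a :: b :: t =>
      have h : 2 ≤ (a :: b :: t).length := by simp
      ⁅lyndonPi ((a :: b :: t).take (stdCut (a :: b :: t) h)),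
        lyndonPi ((a :: b :: t).drop (stdCut (a :: b :: t) h))⁆
  termination_by w => w.length
  decreasing_by
    all_goals
      have := stdCut_spec (a :: b :: t) h
      simp only [List.length_take, List.length_drop]
      omega

open Classical in
/-- The family `Π_w`: if `w = l_1 l_2 ... l_n` with `l_1 ≥ l_2 ≥ ... ≥ l_n` Lyndon words, then
`Π_w = Π_{l_1} Π_{l_2} ... Π_{l_n}`. -/
def PiB (w : Word) : NCPoly k :=
  if h : ∃ L, IsLyndonFactorization L w then (h.choose.map (lyndonPi k)).prod else 0

/-- `s` is the family dual to `Π`: `⟨Π_u | s_v⟩ = δ_{u,v}`. -/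
def IsDualToPi (s : Word → NCPoly k) : Prop :=
  ∀ u v, pairing k (PiB k u) (s v) = if u = v then 1 else 0

open Classical in
/-- The family `Σ_w` dual to `Π_w`. -/
def SigmaB : Word → NCPoly k :=
  if h : ∃ s, IsDualToPi k s then h.choose else 0

end Basis

/-! ### Noncommutative series -/

/-- `R⟪Y⟫`: noncommutative series over `Y`, given by their coefficients. -/
def NCSeries (R : Type*) : Type _ := Word → R

namespace NCSeries

variable {R : Type*} [CommRing R]

instance : AddCommGroup (NCSeries R) := inferInstanceAs (AddCommGroup (Word → R))

/-- Concatenation product: `(S T)(w) = ∑_{w = u v} S(u) T(v)`. -/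
instance : Mul (NCSeries R) :=
  ⟨fun S T w => ∑ i ∈ Finset.range (w.length + 1), S (w.take i) * T (w.drop i)⟩

instance : One (NCSeries R) := ⟨fun w => if w = [] then 1 else 0⟩

theorem mul_apply (S T : NCSeries R) (w : Word) :
    (S * T) w = ∑ i ∈ Finset.range (w.length + 1), S (w.take i) * T (w.drop i) := rfl

theorem add_apply (S T : NCSeries R) (w : Word) : (S + T) w = S w + T w := rfl

theorem one_apply (w : Word) : (1 : NCSeries R) w = if w = [] then 1 else 0 := rfl

/-- Removing a letter on the left. -/
def shift (a : ℕ+) (S : NCSeries R) : NCSeries R := fun w => S (a :: w)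

theorem mul_nil (S T : NCSeries R) : (S * T) [] = S [] * T [] := by
  simp [mul_apply]

theorem mul_cons (S T : NCSeries R) (a : ℕ+) (w : Word) :
    (S * T) (a :: w) = S [] * T (a :: w) + (shift a S * T) w := by
  rw [mul_apply, List.length_cons, Finset.sum_range_succ', mul_apply, add_comm]
  rfl

theorem mul_assoc_apply (T U : NCSeries R) (w : Word) :
    ∀ S : NCSeries R, (S * T * U) w = (S * (T * U)) w := by
  induction w with
  | nil => intro S; simp only [mul_nil, mul_assoc]
  | cons a w ih =>
    intro S
    let T' : NCSeries R := fun v => S [] * shift a T v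
    have h : shift a (S * T) = T' + shift a S * T := by
      funext v; exact mul_cons S T a v
    have h2 : ∀ X Y : NCSeries R, ((X + Y) * U) w = (X * U) w + (Y * U) w := by
      intro X Y
      simp only [mul_apply, add_apply, add_mul, Finset.sum_add_distrib]
    have h3 : (T' * U) w = S [] * (shift a T * U) w := by
      rw [mul_apply, mul_apply, Finset.mul_sum]
      exact Finset.sum_congr rfl fun i _ => mul_assoc _ _ _
    rw [mul_cons, h, h2, h3, ih, mul_cons, mul_cons, mul_nil]
    ring

instance : Ring (NCSeries R) :=
  { (inferInstance : AddCommGroup (NCSeries R)) with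
    mul_assoc := fun S T U => funext fun w => mul_assoc_apply T U w S
    one_mul := fun S => funext fun w => by
      cases w with
      | nil => simp [mul_nil, one_apply]
      | cons a w =>
        rw [mul_cons]
        have : shift a (1 : NCSeries R) = fun _ => 0 := by funext v; simp [shift, one_apply]
        rw [this]
        simp only [one_apply, if_true, one_mul, add_eq_left]
        exact Finset.sum_eq_zero fun i _ => zero_mul _
    mul_one := fun S => funext fun w => by
      rw [mul_apply, Finset.sum_eq_single w.length]
      · simp [one_apply]
      · intro i hi hne
        rw [one_apply, if_neg, mul_zero]
        rw [List.drop_eq_nil_iff]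
        have := Finset.mem_range.1 hi
        omega
      · intro h; simp at h
    left_distrib := fun S T U => funext fun w => by
      simp only [mul_apply, add_apply, mul_add, Finset.sum_add_distrib]
    right_distrib := fun S T U => funext fun w => by
      simp only [mul_apply, add_apply, add_mul, Finset.sum_add_distrib]
    zero_mul := fun S => funext fun w => by
      rw [mul_apply]; exact Finset.sum_eq_zero fun i _ => zero_mul _
    mul_zero := fun S => funext fun w => by
      rw [mul_apply]; exact Finset.sum_eq_zero fun i _ => mul_zero _ }

/-- A series without constant term has powers of increasing order. -/
theorem pow_apply_eq_zero (S : NCSeries R) (h : S [] = 0) (n : ℕ) :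
    ∀ w : Word, w.length < n → (S ^ n) w = 0 := by
  induction n with
  | zero => intro w hw; omega
  | succ n ih =>
    intro w hw
    rw [pow_succ', mul_apply]
    refine Finset.sum_eq_zero fun i hi => ?_
    have := Finset.mem_range.1 hi
    rcases Nat.eq_zero_or_pos i with rfl | hi0
    · rw [List.take_zero, h, zero_mul]
    · rw [ih, mul_zero]
      rw [List.length_drop]; omega

variable [Algebra ℚ R]

/-- `exp S = ∑_n S^n / n!`, for `S` without constant term (then the terms with `n > |w|` do not
contribute to the coefficient of `w`). -/
def exp (S : NCSeries R) : NCSeries R := fun w =>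
  ∑ n ∈ Finset.range (w.length + 1), (1 / (n.factorial : ℚ)) • (S ^ n) w

/-- `log S = ∑_{n ≥ 1} (-1)^{n-1} (S - 1)^n / n`, for `S` with constant term `1` (then the terms with
`n > |w|` do not contribute to the coefficient of `w`). -/
def log (S : NCSeries R) : NCSeries R := fun w =>
  ∑ n ∈ Finset.Icc 1 w.length, ((-1 : ℚ) ^ (n - 1) / n) • ((S - 1) ^ n) w

/-- `S = ∑_w f w` as a locally finite sum of series. -/
def IsSum (f : Word → NCSeries R) (S : NCSeries R) : Prop :=
  ∀ v, {w | f w v ≠ 0}.Finite ∧ S v = ∑ᶠ w, f w v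

/-- `S = ∏ f l`, product over all Lyndon words in decreasing order from left to right: each
coefficient of the finite decreasing products is eventually that of `S`. -/
def IsDecreasingLyndonProd (f : Word → NCSeries R) (S : NCSeries R) : Prop :=
  ∀ w, ∃ F : Finset Word, (∀ l ∈ F, IsLyndon l) ∧
    ∀ L : List Word, (∀ l ∈ L, IsLyndon l) → L.Pairwise (fun l l' => WordLT l' l) →
      (∀ l ∈ F, l ∈ L) → (L.map f).prod w = S w

end NCSeries

section Coproduct

variable (k : Type*) [CommRing k]

/-- The series `q P`, for a quasi-symmetric function `q` and a polynomial `P`. -/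
def scaled (q : QSym k) (P : NCPoly k) : NCSeries (QSym k) := fun w => coeffL k w P • q

/-- The generating series `∑_w M_w w`. -/
def genM : NCSeries (QSym k) := fun w => toQSym k (word k w)

/-- The extension of `Δ_stuffle` to series, `Δ S = ∑_w S(w) Δ(w)`, with values in the completed
tensor square, whose elements are the families of coefficients on the `u ⊗ v`. -/
def coprodSeries (S : NCSeries (QSym k)) : Word → Word → QSym k := fun u v =>
  ∑ᶠ w, coeffTensor k u v (coprod k (word k w)) • S w

/-- `Δ S = S ⊗ S`, with counit `1`. -/
def IsGroupLike (S : NCSeries (QSym k)) : Prop :=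
  S [] = 1 ∧ ∀ u v, coprodSeries k S u v = S u * S v

/-- `Δ S = S ⊗ 1 + 1 ⊗ S`. -/
def IsPrimitive (S : NCSeries (QSym k)) : Prop :=
  ∀ u v, coprodSeries k S u v =
    S u * (1 : NCSeries (QSym k)) v + (1 : NCSeries (QSym k)) u * S v

end Coproduct

end Quasi

end

noncomputable section

namespace Quasi

/-! ### Lyndon words -/

/-! A series with coefficients in a `k`-algebra is the same thing as a linear map on `QSym k`, with
the value at `M k w` equal to the coefficient of `w` (`evalS`). The stuffle coproduct is dual to the
quasi-shuffle product (`coeffTensor_coprod_word`), so group-like means multiplicative and primitive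
means a derivation along the counit. The generating series corresponds to the identity map
(`evalS_genM`), which is an algebra morphism: this is group-likeness.

Deconcatenation is compatible with the quasi-shuffle (`evalS_mul_M_mul_M`), so characters are stable
under products and every power `S ^ n` of a character is a character. The coefficients of `S ^ t`
are polynomials in `t`; the character identity holds at every natural `t`, hence as a polynomial
identity, and its linear coefficient says that the logarithm is primitive (`IsChar.log`). Expanding
the powers of `genM k - 1` shows that `π₁` is the adjoint of the logarithm (`coeffL_piOne`), which
gives the last statement and the primitivity of `π₁(w)`.

Brackets of primitive elements are primitive, so each `Π_l` is primitive. Each `Π_w` is also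
homogeneous for the weight with leading word `w` and leading coefficient one
(`lyndonPi_isHomog_hasLead`). The family is therefore unitriangular on the finite set of words of a
given weight, whence a unique dual family.

For the product formula, it suffices to evaluate both sides against every `Π_u`. A primitive element
acts on products by the Leibniz rule, so `Π_u` applied to `Σ_l ^ n * x` removes `n` copies of `l`
from the Lyndon factors of `u` and produces a descending factorial (`evalS_piS_sigmaQ_pow_mul`). The
factorials of the exponential turn it into a binomial coefficient, and only one term survives for
each `l` (`evalS_prod_expFactor`). -/

theorem wordLT_irrefl (u : Word) : ¬ WordLT u u := fun h => lt_irrefl (α := List ℕ+ᵒᵈ) u h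

/-- `WordLT` unfolds to the strict order of `List ℕ+ᵒᵈ`, so the facts on linear orders apply by
ascription. -/
theorem WordLT.trans {u v w : Word} (h : WordLT u v) (h' : WordLT v w) : WordLT u w :=
  lt_trans (α := List ℕ+ᵒᵈ) h h'

theorem WordLT.asymm {u v : Word} (h : WordLT u v) : ¬ WordLT v u :=
  lt_asymm (α := List ℕ+ᵒᵈ) h

theorem not_wordLT_trans {u v w : Word} (h : ¬ WordLT u v) (h' : ¬ WordLT v w) : ¬ WordLT u w :=
  fun h3 => (not_lt (α := List ℕ+ᵒᵈ).1 h').trans (not_lt (α := List ℕ+ᵒᵈ).1 h) |>.not_gt h3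

theorem wordLT_trichotomy (u v : Word) : WordLT u v ∨ u = v ∨ WordLT v u :=
  lt_trichotomy (α := List ℕ+ᵒᵈ) u v

theorem wordLT_of_wordLT_of_not {u v w : Word} (h : WordLT u v) (h' : ¬ WordLT w v) :
    WordLT u w :=
  lt_of_lt_of_le (α := List ℕ+ᵒᵈ) h (not_lt (α := List ℕ+ᵒᵈ).1 h')

theorem not_wordLT_nil (u : Word) : ¬ WordLT u [] := by
  intro h; cases h

theorem wordLT_cons_iff {a b : ℕ+} {u v : Word} :
    WordLT (a :: u) (b :: v) ↔ b < a ∨ a = b ∧ WordLT u v := by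
  constructor
  · intro h
    cases h with
    | cons h => exact Or.inr ⟨rfl, h⟩
    | rel h => exact Or.inl h
  · rintro (h | ⟨rfl, h⟩)
    · exact List.Lex.rel h
    · exact List.Lex.cons h

theorem not_append_wordLT (u v : Word) : ¬ WordLT (u ++ v) u := by
  induction u with
  | nil => exact not_wordLT_nil _
  | cons a u ih =>
    rw [List.cons_append, wordLT_cons_iff]
    rintro (h | ⟨-, h⟩)
    · exact lt_irrefl _ h
    · exact ih h

theorem append_wordLT_append_left_iff (u v w : Word) :
    WordLT (u ++ v) (u ++ w) ↔ WordLT v w := by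
  induction u with
  | nil => rfl
  | cons a u ih => simp [wordLT_cons_iff, ih]

/-- The comparison is decided at a letter present in both words, so whatever follows is irrelevant.
-/
theorem WordLT.append_of_not_prefix {u v : Word} (h : WordLT u v) (hp : ¬ u <+: v) (x y : Word) :
    WordLT (u ++ x) (v ++ y) := by
  induction u generalizing v with
  | nil => exact absurd (List.nil_prefix) hp
  | cons a u ih =>
    cases v with
    | nil => exact absurd h (not_wordLT_nil _)
    | cons b v =>
      rw [wordLT_cons_iff] at h
      rw [List.cons_append, List.cons_append, wordLT_cons_iff]
      rcases h with h | ⟨rfl, h⟩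
      · exact Or.inl h
      · exact Or.inr ⟨rfl, ih h fun hp' => hp (List.cons_prefix_cons.2 ⟨rfl, hp'⟩)⟩

theorem WordLT.append_of_length_le {u v : Word} (h : WordLT u v) (hl : v.length ≤ u.length)
    (x y : Word) : WordLT (u ++ x) (v ++ y) := by
  refine h.append_of_not_prefix (fun hp => ?_) x y
  rw [hp.eq_of_length_le hl] at h
  exact wordLT_irrefl _ h

theorem IsLyndon.length_pos {l : Word} (h : IsLyndon l) : 0 < l.length :=
  List.length_pos_iff.2 h.1

theorem IsLyndon.wordLT_of_append {u v : Word} (h : IsLyndon (u ++ v)) (hu : u ≠ [])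
    (hv : v ≠ []) : WordLT (u ++ v) v := by
  have := h.2 u.length (List.length_pos_iff.2 hu) (by simp [List.length_pos_iff.2 hv])
  simpa using this

theorem isLyndon_of_forall {l : Word} (h0 : l ≠ [])
    (h : ∀ u v : Word, l = u ++ v → u ≠ [] → v ≠ [] → WordLT l v) : IsLyndon l :=
  ⟨h0, fun i hi hl => h (l.take i) (l.drop i) (List.take_append_drop i l).symm
    (fun h' => by
      have := congrArg List.length h'
      simp only [List.length_take, List.length_nil] at this; omega)
    (fun h' => by
      have := congrArg List.length h'
      simp only [List.length_drop, List.length_nil] at this; omega)⟩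

/-- The main point is `u v < v`: either `u` is a prefix of `v`, and cancelling it leaves the Lyndon
property of `v`, or the inequality `u < v` is decided at a letter. A suffix inside `v` is even
larger; a suffix `z v` with `z` a proper suffix of `u` exceeds `u v` because `u < z` is decided at a
letter, `z` being shorter than `u`. -/
theorem IsLyndon.append {u v : Word} (hu : IsLyndon u) (hv : IsLyndon v) (h : WordLT u v) :
    IsLyndon (u ++ v) := by
  have huv : WordLT (u ++ v) v := by
    by_cases hp : u <+: v
    · obtain ⟨v', rfl⟩ := hp
      rw [append_wordLT_append_left_iff]
      refine hv.wordLT_of_append hu.1 ?_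
      rintro rfl
      rw [List.append_nil] at h
      exact wordLT_irrefl _ h
    · simpa using h.append_of_not_prefix hp v []
  refine isLyndon_of_forall (by simp [hu.1]) fun x y hxy hx hy => ?_
  rcases List.append_eq_append_iff.1 hxy with ⟨z, rfl, rfl⟩ | ⟨z, rfl, rfl⟩
  · by_cases hz : z = []
    · subst hz; exact huv
    · exact huv.trans (hv.wordLT_of_append hz hy)
  · by_cases hz : z = []
    · subst hz; simpa using huv
    · refine (hu.wordLT_of_append hx hz).append_of_length_le ?_ _ _
      simp

/-- While the new word is smaller than the head of the list, the two merge into a longer Lyndon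
word; otherwise it can be put in front. -/
theorem IsLyndonFactorization.exists_append {L : List Word} : ∀ {l w : Word}, IsLyndon l →
    IsLyndonFactorization L w → ∃ L', IsLyndonFactorization L' (l ++ w) := by
  induction L with
  | nil =>
    rintro l w hl ⟨-, -, rfl⟩
    exact ⟨[l], by simpa using hl, by simp, by simp⟩
  | cons m L ih =>
    rintro l w hl ⟨h1, h2, rfl⟩
    simp only [List.mem_cons, forall_eq_or_imp] at h1
    rw [List.pairwise_cons] at h2
    by_cases hlm : WordLT l m
    · have := ih (hl.append h1.1 hlm) ⟨h1.2, h2.2, rfl⟩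
      simpa using this
    · refine ⟨l :: m :: L, ?_, ?_, by simp⟩
      · simpa using ⟨hl, h1⟩
      · rw [List.pairwise_cons, List.pairwise_cons]
        refine ⟨?_, h2⟩
        simp only [List.mem_cons, forall_eq_or_imp]
        exact ⟨hlm, fun l' hl' => not_wordLT_trans hlm (h2.1 l' hl')⟩

theorem exists_lyndonFactorization (w : Word) : ∃ L, IsLyndonFactorization L w := by
  induction w with
  | nil => exact ⟨[], by simp, by simp, rfl⟩
  | cons a w ih =>
    obtain ⟨L, hL⟩ := ih
    exact hL.exists_append (isLyndon_letter a)

/-- The prefix `z` ends inside, or at the end of, some factor `l`. Its part in that factor is a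
prefix of `l`, hence at most `l`, hence at most `a`. -/
theorem exists_suffix_not_wordLT (a : Word) (L : List Word) :
    ∀ z : Word, z ≠ [] → z <+: L.flatten → (∀ l ∈ L, ¬ WordLT a l) →
      ∃ x y : Word, z = y ++ x ∧ x ≠ [] ∧ ¬ WordLT a x := by
  induction L with
  | nil =>
    intro z hz hp _
    exact absurd (List.prefix_nil.1 (by simpa using hp)) hz
  | cons l L ih =>
    intro z hz hp hL
    simp only [List.mem_cons, forall_eq_or_imp] at hL
    rw [List.flatten_cons] at hp
    obtain ⟨t, ht⟩ := hp
    rcases List.append_eq_append_iff.1 ht with ⟨s, rfl, -⟩ | ⟨z', rfl, h⟩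
    · exact ⟨z, [], by simp, hz, not_wordLT_trans hL.1 (not_append_wordLT _ _)⟩
    · by_cases hz' : z' = []
      · subst hz'
        exact ⟨l, [], by simp, by simpa using hz, hL.1⟩
      · obtain ⟨x, y, rfl, hx, hax⟩ := ih z' hz' ⟨t, h.symm⟩ hL.2
        exact ⟨x, l ++ y, by simp, hx, hax⟩

/-- If `m` were longer than `l`, then `m = l z` with `z` a prefix of the remaining factors, all at
most `l`. A suffix `x ≤ l` of `z` would give `m < x ≤ l`, although `l` is a prefix of `m`. -/
theorem IsLyndonFactorization.length_head_le {l m : Word} {L K : List Word} {w : Word}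
    (hL : IsLyndonFactorization (l :: L) w) (hK : IsLyndonFactorization (m :: K) w) :
    m.length ≤ l.length := by
  by_contra! hlt
  obtain ⟨hL1, hL2, hL3⟩ := hL
  obtain ⟨hK1, -, hK3⟩ := hK
  rw [List.pairwise_cons] at hL2
  rw [List.flatten_cons] at hL3 hK3
  have hlm : l <+: m := List.prefix_of_prefix_length_le ⟨_, hL3⟩ ⟨_, hK3⟩ hlt.le
  obtain ⟨z, rfl⟩ := hlm
  have hz : z ≠ [] := by rintro rfl; simp at hlt
  have hp : z <+: L.flatten := by
    rw [← hL3, List.append_assoc, List.append_cancel_left_eq] at hK3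
    exact ⟨_, hK3⟩
  obtain ⟨x, y, rfl, hx, hax⟩ := exists_suffix_not_wordLT l L z hz hp hL2.1
  have hm : IsLyndon (l ++ (y ++ x)) := hK1 _ (by simp)
  have h1 : WordLT (l ++ (y ++ x)) x := by
    rw [← List.append_assoc] at hm ⊢
    exact hm.wordLT_of_append (by simp [(hL1 l (by simp)).1]) hx
  exact not_append_wordLT l (y ++ x) (wordLT_of_wordLT_of_not h1 hax)

theorem IsLyndonFactorization.unique {L : List Word} : ∀ {K : List Word} {w : Word},
    IsLyndonFactorization L w → IsLyndonFactorization K w → L = K := by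
  induction L with
  | nil =>
    rintro K w ⟨-, -, rfl⟩ ⟨h1, -, h3⟩
    cases K with
    | nil => rfl
    | cons m K =>
      rw [List.flatten_nil, List.flatten_cons, List.append_eq_nil_iff] at h3
      exact absurd h3.1 (h1 m (by simp)).1
  | cons l L ih =>
    intro K w hL hK
    cases K with
    | nil =>
      obtain ⟨-, -, rfl⟩ := hK
      have h3 := hL.2.2
      rw [List.flatten_nil, List.flatten_cons, List.append_eq_nil_iff] at h3
      exact absurd h3.1 (hL.1 l (by simp)).1
    | cons m K =>
      have hlen : l.length = m.length := le_antisymm (hK.length_head_le hL) (hL.length_head_le hK)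
      obtain ⟨hL1, hL2, hL3⟩ := hL
      obtain ⟨hK1, hK2, hK3⟩ := hK
      rw [List.flatten_cons] at hL3 hK3
      obtain ⟨rfl, h⟩ := List.append_inj (hL3.trans hK3.symm) hlen
      rw [ih ⟨fun x hx => hL1 x (by simp [hx]), (List.pairwise_cons.1 hL2).2, rfl⟩
        ⟨fun x hx => hK1 x (by simp [hx]), (List.pairwise_cons.1 hK2).2, h.symm⟩]

theorem IsLyndonFactorization.sublist {L K : List Word} {w : Word}
    (h : IsLyndonFactorization L w) (hK : K.Sublist L) : IsLyndonFactorization K K.flatten :=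
  ⟨fun l hl => h.1 l (hK.subset hl), h.2.1.sublist hK, rfl⟩

theorem IsLyndon.factorization {l : Word} (h : IsLyndon l) : IsLyndonFactorization [l] l :=
  ⟨by simpa using h, by simp, by simp⟩

/-- The left factor of the standard factorization of a Lyndon word is a Lyndon word. -/
theorem isLyndon_take_stdCut {l : Word} (hl : IsLyndon l) (h : 2 ≤ l.length) :
    IsLyndon (l.take (stdCut l h)) := by
  classical
  obtain ⟨h0, h1, h2⟩ := stdCut_spec l h
  set c := stdCut l h with hc
  have hmax : ∀ i, 0 < i → i < c → ¬ IsLyndon (l.drop i) := fun i hi hic hli =>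
    Nat.find_min (exists_lyndon_suffix l h) (m := i) hic ⟨hi, by omega, hli⟩
  -- Let `a` and `m` be the first and last Lyndon factors of the left part, and `r` the right part.
  -- With at least two factors, `m < r` would make `m r` a longer proper Lyndon suffix, against the
  -- choice of the cut; and `r ≤ m ≤ a` gives `l < r ≤ a`, impossible since `a` is a prefix of `l`.
  obtain ⟨L, hL⟩ := exists_lyndonFactorization (l.take c)
  obtain rfl | ⟨K, m, rfl⟩ := L.eq_nil_or_concat
  · have := congrArg List.length hL.2.2
    simp only [List.flatten_nil, List.length_nil, List.length_take] at this
    omega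
  · have hm : IsLyndon m := hL.1 m (by simp)
    have hfl : K.flatten ++ m = l.take c := by simpa using hL.2.2
    cases K with
    | nil =>
      rw [← hfl]; simpa using hm
    | cons a K =>
      exfalso
      have ha : IsLyndon a := hL.1 a (by simp)
      have hdec : l = (a :: K).flatten ++ (m ++ l.drop c) := by
        rw [← List.append_assoc, hfl, List.take_append_drop]
      have hmr : ¬ WordLT m (l.drop c) := by
        intro hlt
        refine hmax (a :: K).flatten.length ?_ ?_ ?_
        · have := ha.length_pos
          rw [List.flatten_cons, List.length_append]; omega
        · have h5 := congrArg List.length hfl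
          rw [List.length_append, List.length_take, min_eq_left h1.le] at h5
          have := hm.length_pos
          omega
        · have h6 : l.drop (a :: K).flatten.length = m ++ l.drop c := by
            conv_lhs => rw [hdec]
            exact List.drop_left
          rw [h6]
          exact hm.append h2 hlt
      have ham : ¬ WordLT a m := by
        have := hL.2.1
        rw [List.concat_eq_append, List.cons_append, List.pairwise_cons] at this
        exact this.1 m (by simp)
      have hlr : WordLT l (l.drop c) := hl.2 c h0 h1
      have h7 : WordLT l a := wordLT_of_wordLT_of_not hlr (not_wordLT_trans ham hmr)
      rw [hdec, List.flatten_cons, List.append_assoc] at h7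
      exact not_append_wordLT _ _ h7

/-! ### Series as linear maps on quasi-symmetric functions -/

open QSym

section EvalS

variable {k : Type*} [CommRing k]

namespace QSym

/-- The coefficient of `M_w` in a quasi-symmetric function. -/
def coord (w : Word) : QSym k →ₗ[k] k := (Finsupp.lapply w : (Word →₀ k) →ₗ[k] k)

theorem coord_M (w u : Word) : coord w (M k u) = if u = w then 1 else 0 := by
  classical
  exact Finsupp.single_apply

theorem ext_coord {x y : QSym k} (h : ∀ w, coord w x = coord w y) : x = y :=
  Finsupp.ext (f := (x : Word →₀ k)) (g := y) h

theorem hom_ext {N : Type*} [AddCommMonoid N] [Module k N] {f g : QSym k →ₗ[k] N}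
    (h : ∀ w, f (M k w) = g (M k w)) : f = g :=
  Finsupp.lhom_ext' (R := k) fun w => LinearMap.ext_ring (h w)

theorem M_nil : M k [] = 1 := rfl

/-- Prepending a letter to a composition. -/
def pre (a : ℕ+) : QSym k →ₗ[k] QSym k := (prepend a : (Word →₀ k) →ₗ[k] (Word →₀ k))

theorem pre_M (a : ℕ+) (u : Word) : pre a (M k u) = M k (a :: u) := prepend_single a u 1

theorem M_cons_mul_M_cons (i j : ℕ+) (u v : Word) :
    M k (i :: u) * M k (j :: v) = pre j (M k (i :: u) * M k v) + pre i (M k u * M k (j :: v))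
      + pre (i + j) (M k u * M k v) := by
  rw [← pre_M, ← pre_M]
  exact stuffleMul_prepend i j _ _

end QSym

variable {R : Type*} [CommRing R] [Algebra k R]

variable (k) in
/-- The linear map on quasi-symmetric functions which takes the value `S w` at `M_w`. -/
def evalS (S : NCSeries R) : QSym k →ₗ[k] R :=
  (Finsupp.lift R k Word S : (Word →₀ k) →ₗ[k] R)

theorem evalS_M (S : NCSeries R) (w : Word) : evalS k S (M k w) = S w := by
  have h : ∀ f : Word → R, Finsupp.lift R k Word f (Finsupp.single w 1) = f w := fun f => by simp
  exact h S

theorem evalS_one (S : NCSeries R) : evalS k S 1 = S [] := by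
  rw [← M_nil, evalS_M]

/-- Applying a map to all the coefficients of a series. -/
def NCSeries.map {A B : Type*} (f : A → B) (S : NCSeries A) : NCSeries B := fun w => f (S w)

theorem comp_evalS {R' : Type*} [CommRing R'] [Algebra k R'] (f : R →ₗ[k] R') (S : NCSeries R) :
    f ∘ₗ evalS k S = evalS k (S.map f) :=
  hom_ext fun w => by simp only [evalS_M, LinearMap.comp_apply, NCSeries.map]

/-- Through this identification, multiplicativity of the generating series becomes a tautology. -/
theorem evalS_genM : evalS k (genM k) = LinearMap.id :=
  hom_ext fun w => by
    rw [evalS_M]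
    have h : ∀ f : Word → QSym k,
        Finsupp.lift (QSym k) k Word f (Finsupp.single w 1) = f w := fun f => by simp
    exact h (M k)

theorem genM_apply (w : Word) : genM k w = M k w := by
  rw [← evalS_M (k := k) (genM k), evalS_genM, LinearMap.id_apply]

theorem evalS_pre_mul (S T : NCSeries R) (a : ℕ+) (x : QSym k) :
    evalS k (S * T) (pre a x) =
      S [] * evalS k T (pre a x) + evalS k (NCSeries.shift a S * T) x := by
  have : evalS k (S * T) ∘ₗ pre a = (LinearMap.mulLeft k (S []) ∘ₗ evalS k T ∘ₗ pre a)
      + evalS k (NCSeries.shift a S * T) :=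
    hom_ext fun w => by
      simp only [LinearMap.comp_apply, LinearMap.add_apply, pre_M, evalS_M,
        LinearMap.mulLeft_apply, NCSeries.mul_cons]
  exact LinearMap.congr_fun this x

theorem evalS_pre (S : NCSeries R) (a : ℕ+) (x : QSym k) :
    evalS k S (pre a x) = evalS k (NCSeries.shift a S) x := by
  have : evalS k S ∘ₗ pre a = evalS k (NCSeries.shift a S) :=
    hom_ext fun w => by
      simp only [LinearMap.comp_apply, pre_M, evalS_M, NCSeries.shift]
  exact LinearMap.congr_fun this x

/-- The coproduct dual to the quasi-shuffle product is multiplicative. -/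
theorem evalS_mul_M_mul_M (T : NCSeries R) (u v : Word) : ∀ S : NCSeries R,
    evalS k (S * T) (M k u * M k v) =
      ∑ p ∈ Finset.range (u.length + 1), ∑ q ∈ Finset.range (v.length + 1),
        evalS k S (M k (u.take p) * M k (v.take q)) *
          evalS k T (M k (u.drop p) * M k (v.drop q)) := by
  induction u, v using stuffle.induct with
  | case1 w =>
    intro S
    simp [M_nil, evalS_M, NCSeries.mul_apply]
  | case2 i u =>
    intro S
    simp [M_nil, evalS_M, NCSeries.mul_apply]
  | case3 i u j v h1 h2 h3 =>
    intro S
    have e : evalS k (S * T) (M k (i :: u) * M k (j :: v)) =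
        S [] * evalS k T (M k (i :: u) * M k (j :: v))
        + evalS k (NCSeries.shift j S * T) (M k (i :: u) * M k v)
        + evalS k (NCSeries.shift i S * T) (M k u * M k (j :: v))
        + evalS k (NCSeries.shift (i + j) S * T) (M k u * M k v) := by
      rw [M_cons_mul_M_cons]
      simp only [map_add, evalS_pre_mul]
      ring
    rw [e, h1, h2, h3]
    simp only [List.length_cons]
    -- The terms with `p = 0` or `q = 0` are split off. In those with both cuts positive, the left
    -- factor expands by the quasi-shuffle recursion into three shifted evaluations, matching the
    -- three induction hypotheses.
    simp only [Finset.sum_range_succ' _ (v.length + 1), Finset.sum_range_succ' _ (u.length + 1)]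
    simp only [List.take_succ_cons, List.drop_succ_cons, List.take_zero, List.drop_zero,
      M_cons_mul_M_cons, map_add, evalS_pre, M_nil, one_mul, mul_one, evalS_M, add_mul,
      Finset.sum_add_distrib, NCSeries.shift, evalS_one]
    abel

end EvalS

/-! ### Duality between the stuffle coproduct and the quasi-shuffle product -/

section Coproduct

variable {k : Type*} [CommRing k]

theorem coeffL_word (w u : Word) : coeffL k w (word k u) = if u = w then 1 else 0 := by
  classical
  have : coeffL k w (word k u) = if FreeMonoid.ofList u = FreeMonoid.ofList w then 1 else 0 := by
    exact Finsupp.single_apply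
  rw [this]
  exact if_congr FreeMonoid.ofList.injective.eq_iff rfl rfl

theorem word_mul_word (u v : Word) : word k u * word k v = word k (u ++ v) := by
  simp [word, MonoidAlgebra.single_mul_single]

theorem NCPoly.hom_ext {N : Type*} [AddCommMonoid N] [Module k N] {f g : NCPoly k →ₗ[k] N}
    (h : ∀ w, f (word k w) = g (word k w)) : f = g := by
  have : f ∘ₗ (MonoidAlgebra.coeffLinearEquiv k).symm.toLinearMap
      = g ∘ₗ (MonoidAlgebra.coeffLinearEquiv k).symm.toLinearMap :=
    Finsupp.lhom_ext' fun w => LinearMap.ext_ring (h w.toList)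
  exact LinearMap.ext fun x => LinearMap.congr_fun this (MonoidAlgebra.coeff x)

theorem coeffL_word_mul (w p : Word) (P : NCPoly k) :
    coeffL k w (word k p * P) = if p <+: w then coeffL k (w.drop p.length) P else 0 := by
  have : coeffL k w ∘ₗ LinearMap.mulLeft k (word k p) =
      if p <+: w then coeffL k (w.drop p.length) else 0 :=
    NCPoly.hom_ext fun u => by
      rw [LinearMap.comp_apply, LinearMap.mulLeft_apply, word_mul_word, coeffL_word]
      by_cases h : p <+: w
      · obtain ⟨t, rfl⟩ := h
        simp [coeffL_word]
      · rw [if_neg h, LinearMap.zero_apply, if_neg]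
        rintro rfl
        exact h (List.prefix_append _ _)
  have h2 := LinearMap.congr_fun this P
  rw [LinearMap.comp_apply, LinearMap.mulLeft_apply] at h2
  rw [h2]
  split_ifs <;> rfl

theorem coeffTensor_tmul (u v : Word) (P Q : NCPoly k) :
    coeffTensor k u v (P ⊗ₜ Q) = coeffL k u P * coeffL k v Q := rfl

theorem coeffTensor_word_tmul_word_mul (u v p q : Word) (t : NCPoly k ⊗[k] NCPoly k) :
    coeffTensor k u v ((word k p ⊗ₜ word k q) * t) =
      if p <+: u ∧ q <+: v then coeffTensor k (u.drop p.length) (v.drop q.length) t else 0 := by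
  induction t using TensorProduct.induction_on with
  | zero => simp
  | add x y hx hy =>
    rw [mul_add, map_add, hx, hy]
    split_ifs <;> simp
  | tmul P Q =>
    rw [Algebra.TensorProduct.tmul_mul_tmul]
    simp only [coeffTensor_tmul, coeffL_word_mul]
    by_cases h1 : p <+: u <;> by_cases h2 : q <+: v <;> simp [h1, h2]

theorem word_nil : word k [] = 1 := rfl

theorem coprod_word_cons (a : ℕ+) (w : Word) :
    coprod k (word k (a :: w)) = coprodLetter k a * coprod k (word k w) := by
  have hw : word k (a :: w) = word k [a] * word k w := (word_mul_word [a] w).symm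
  have hc : coprod k (word k [a]) = coprodLetter k a := by
    rw [coprod, word, MonoidAlgebra.lift_single, one_smul]
    exact FreeMonoid.lift_eval_of _ _
  rw [hw, map_mul, hc]

theorem coeffTensor_coprodLetter_mul (a : ℕ+) (u v : Word) (t : NCPoly k ⊗[k] NCPoly k) :
    coeffTensor k u v (coprodLetter k a * t) =
      (if [a] <+: u then coeffTensor k (u.drop 1) v t else 0)
      + (if [a] <+: v then coeffTensor k u (v.drop 1) t else 0)
      + ∑ i ∈ Finset.Ico 1 a, if [i] <+: u ∧ [a - i] <+: v then
          coeffTensor k (u.drop 1) (v.drop 1) t else 0 := by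
  rw [coprodLetter, ← word_nil]
  simp only [add_mul, Finset.sum_mul, map_add, map_sum, coeffTensor_word_tmul_word_mul]
  simp

theorem QSym.coord_cons_pre (a b : ℕ+) (w : Word) (x : QSym k) :
    coord (a :: w) (pre b x) = if b = a then coord w x else 0 := by
  have : coord (a :: w) ∘ₗ pre b = if b = a then coord w else (0 : QSym k →ₗ[k] k) :=
    QSym.hom_ext fun u => by
      rw [LinearMap.comp_apply, pre_M, coord_M]
      by_cases h : b = a <;> simp [h, coord_M]
  have h2 := LinearMap.congr_fun this x
  rw [LinearMap.comp_apply] at h2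
  rw [h2]
  split_ifs <;> rfl

/-- The coproduct is dual to the quasi-shuffle product. -/
theorem coeffTensor_coprod_word (w : Word) : ∀ u v : Word,
    coeffTensor k u v (coprod k (word k w)) = coord w (M k u * M k v) := by
  induction w with
  | nil =>
    intro u v
    rw [word_nil, map_one, Algebra.TensorProduct.one_def, coeffTensor_tmul, ← word_nil]
    cases u with
    | nil => simp [coeffL_word, M_nil, ← coord_M (k := k) [] v, eq_comm]
    | cons i u =>
      cases v with
      | nil => simp [coeffL_word, M_nil, coord_M]
      | cons j v =>
        have h : ∀ (b : ℕ+) (x : QSym k), coord [] (pre b x) = 0 := fun b x => by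
          have : coord [] ∘ₗ pre b = (0 : QSym k →ₗ[k] k) :=
            QSym.hom_ext fun u => by simp [pre_M, coord_M]
          exact LinearMap.congr_fun this x
        simp [coeffL_word, M_cons_mul_M_cons, h]
  | cons a w ih =>
    intro u v
    rw [coprod_word_cons, coeffTensor_coprodLetter_mul]
    cases u with
    | nil =>
      cases v with
      | nil =>
        rw [M_nil, one_mul, ← M_nil, coord_M]
        simp
      | cons j v =>
        simp only [List.prefix_nil, List.cons_ne_nil, if_false, false_and, Finset.sum_const_zero,
          add_zero, zero_add, M_nil, one_mul, ih, coord_M, List.drop_one, List.tail_cons]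
        simp [List.cons_prefix_cons, ite_and, eq_comm]
    | cons i u =>
      cases v with
      | nil =>
        simp only [List.prefix_nil, List.cons_ne_nil, if_false, and_false, Finset.sum_const_zero,
          add_zero, M_nil, mul_one, ih, coord_M, List.drop_one, List.tail_cons]
        simp [List.cons_prefix_cons, ite_and, eq_comm]
      | cons j v =>
        simp only [ih, List.drop_one, List.tail_cons, M_cons_mul_M_cons, map_add, coord_cons_pre,
          List.cons_prefix_cons, List.nil_prefix, and_true]
        rw [add_comm (if a = i then _ else _)]
        congr 1
        · simp only [eq_comm]
        -- Among the terms `y_b ⊗ y_{a-b}` only `b = i` with `a - b = j` matches the first letters,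
        -- which is the contracted term of the quasi-shuffle.
        · by_cases h : i + j = a
          · subst h
            have h1 : ∀ x y : ℕ+, x + y - x = y := fun x y => by
              rw [← PNat.coe_inj, PNat.sub_coe, if_pos (PNat.lt_add_right x y)]; simp
            rw [if_pos rfl, Finset.sum_eq_single i]
            · rw [if_pos ⟨rfl, h1 i j⟩]
            · intro b _ hb
              rw [if_neg fun h => hb h.1]
            · intro hi
              exact absurd (Finset.mem_Ico.2 ⟨one_le, PNat.lt_add_right i j⟩) hi
          · rw [if_neg h]
            refine Finset.sum_eq_zero fun b hb => if_neg ?_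
            rintro ⟨rfl, rfl⟩
            exact h (PNat.add_sub_of_lt (Finset.mem_Ico.1 hb).2)

theorem evalS_eq_finsum {R : Type*} [CommRing R] [Algebra k R] (S : NCSeries R) (x : QSym k) :
    evalS k S x = ∑ᶠ w, coord w x • S w := by
  have h : evalS k S x = Finsupp.sum (x : Word →₀ k) fun w a => a • S w := by
    exact Finsupp.lift_apply (R := k) (M := R) (X := Word) S x
  rw [h, finsum_eq_sum_of_support_subset (s := Finsupp.support (x : Word →₀ k))]
  · rfl
  · intro w hw
    by_contra h0
    refine hw ?_
    have h1 : coord w x = 0 := Finsupp.notMem_support_iff.1 h0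
    change coord w x • S w = 0
    rw [h1, zero_smul]

/-- This translates group-like and primitive series into characters and derivations along the
counit. -/
theorem coprodSeries_eq (S : NCSeries (QSym k)) (u v : Word) :
    coprodSeries k S u v = evalS k S (M k u * M k v) := by
  rw [evalS_eq_finsum]
  simp only [coprodSeries, coeffTensor_coprod_word]

theorem isGroupLike_genM : IsGroupLike k (genM k) := by
  refine ⟨by rw [genM_apply, M_nil], fun u v => ?_⟩
  rw [coprodSeries_eq, evalS_genM, LinearMap.id_apply, genM_apply, genM_apply]

end Coproduct

/-! ### Characters and their logarithms -/

section Char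

variable {k : Type*} [CommRing k] {R : Type*} [CommRing R] [Algebra k R]

theorem evalS_zero : evalS k (0 : NCSeries R) = 0 :=
  hom_ext fun w => by rw [evalS_M]; rfl

theorem NCSeries.shift_one (a : ℕ+) : NCSeries.shift a (1 : NCSeries R) = 0 := by
  funext w
  simp [NCSeries.shift, NCSeries.one_apply]
  rfl

theorem NCSeries.sum_apply {ι : Type*} (s : Finset ι) (f : ι → NCSeries R) (w : Word) :
    (∑ i ∈ s, f i) w = ∑ i ∈ s, f i w :=
  map_sum (Pi.evalAddMonoidHom (fun _ : Word => R) w : NCSeries R →+ R) f s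

theorem NCSeries.sub_one_nil {S : NCSeries R} (h : S [] = 1) : (S - 1) [] = 0 := by
  change S [] - (1 : NCSeries R) [] = 0
  simp [h, NCSeries.one_apply]

variable (k) in
/-- A series is a character if it is multiplicative for the quasi-shuffle product. -/
def IsChar (S : NCSeries R) : Prop :=
  S [] = 1 ∧ ∀ u v, evalS k S (M k u * M k v) = S u * S v

theorem isChar_one : IsChar k (1 : NCSeries R) := by
  refine ⟨by simp [NCSeries.one_apply], fun u v => ?_⟩
  cases u with
  | nil => simp [M_nil, evalS_M, NCSeries.one_apply]
  | cons i u =>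
    cases v with
    | nil => simp [M_nil, evalS_M, NCSeries.one_apply]
    | cons j v =>
      simp [M_cons_mul_M_cons, evalS_pre, NCSeries.shift_one, evalS_zero, NCSeries.one_apply]

/-- The sum over pairs of cuts given by `evalS_mul_M_mul_M` factors into two sums over single cuts.
-/
theorem IsChar.mul {S T : NCSeries R} (hS : IsChar k S) (hT : IsChar k T) :
    IsChar k (S * T) := by
  refine ⟨by rw [NCSeries.mul_nil, hS.1, hT.1, one_mul], fun u v => ?_⟩
  rw [evalS_mul_M_mul_M, NCSeries.mul_apply, NCSeries.mul_apply, Finset.sum_mul_sum]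
  refine Finset.sum_congr rfl fun p _ => Finset.sum_congr rfl fun q _ => ?_
  rw [hS.2, hT.2]
  ring

theorem IsChar.pow {S : NCSeries R} (hS : IsChar k S) (n : ℕ) : IsChar k (S ^ n) := by
  induction n with
  | zero => rw [pow_zero]; exact isChar_one
  | succ n ih => rw [pow_succ]; exact ih.mul hS

theorem IsChar.evalS_mul {S : NCSeries R} (hS : IsChar k S) (x y : QSym k) :
    evalS k S (x * y) = evalS k S x * evalS k S y := by
  have h1 : ∀ u, evalS k S ∘ₗ LinearMap.mulLeft k (M k u)
      = LinearMap.mulLeft k (S u) ∘ₗ evalS k S := fun u =>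
    hom_ext fun v => by simp [evalS_M, hS.2]
  have h2 : evalS k S ∘ₗ LinearMap.mulRight k y
      = LinearMap.mulRight k (evalS k S y) ∘ₗ evalS k S :=
    hom_ext fun u => by simpa [evalS_M] using LinearMap.congr_fun (h1 u) y
  simpa using LinearMap.congr_fun h2 x

end Char

/-! ### Powers of a series as polynomials in the exponent -/

section Polynomial

open Polynomial

/-- A polynomial over a `ℚ`-algebra vanishing at all the natural numbers is zero. -/
theorem polynomial_eq_zero_of_eval_natCast {R : Type*} [CommRing R] [Algebra ℚ R] (d : ℕ) :
    ∀ p : R[X], p.natDegree ≤ d → (∀ n : ℕ, p.eval (n : R) = 0) → p = 0 := by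
  induction d with
  | zero =>
    intro p hp h
    rw [eq_C_of_natDegree_le_zero hp] at h ⊢
    simpa using h 0
  | succ d ih =>
    intro p hp h
    have h0 : p.coeff 0 = 0 := by simpa [coeff_zero_eq_eval_zero] using h 0
    have hp0 : p.divX * X = p := by
      have := divX_mul_X_add p
      rwa [h0, C_0, add_zero] at this
    -- Since `p = q X` and `n + 1` is invertible, `q` vanishes at every `n + 1`; the shift by one
    -- brings `q` back to the induction hypothesis in lower degree.
    have hq : taylor 1 p.divX = 0 := by
      refine ih _ ?_ fun n => ?_
      · rw [natDegree_taylor, natDegree_divX_eq_natDegree_tsub_one]; omega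
      · have h1 := h (n + 1)
        rw [← hp0, eval_mul, eval_X] at h1
        have hu : IsUnit (((n + 1 : ℕ) : R)) := by
          have h2 : IsUnit ((n + 1 : ℕ) : ℚ) := by
            rw [isUnit_iff_ne_zero]; positivity
          simpa using h2.map (algebraMap ℚ R)
        rw [taylor_eval]
        have := hu.mul_left_eq_zero.1 h1
        simpa using this
    rw [← hp0, taylor_injective 1 (hq.trans (map_zero _).symm), zero_mul]

/-- The binomial coefficient `X (X - 1) ... (X - j + 1) / j!` as a polynomial. -/
def binomPoly : ℕ → ℚ[X]
  | 0 => 1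
  | j + 1 => binomPoly j * (X - C (j : ℚ)) * C (1 / (j + 1 : ℚ))

theorem binomPoly_eval (n j : ℕ) : (binomPoly j).eval (n : ℚ) = n.choose j := by
  induction j with
  | zero => simp [binomPoly]
  | succ j ih =>
    have h : ((n.choose (j + 1) : ℚ)) * (j + 1) = n.choose j * (n - j) := by
      rcases le_or_gt j n with hj | hj
      · have := Nat.choose_succ_right_eq n j
        rw [← Nat.cast_sub hj]
        exact_mod_cast this
      · rw [Nat.choose_eq_zero_of_lt hj, Nat.choose_eq_zero_of_lt (by omega)]
        simp
    rw [binomPoly, eval_mul, eval_mul, ih, eval_sub, eval_X, eval_C, eval_C, ← h]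
    field_simp

theorem binomPoly_coeff_zero (j : ℕ) : (binomPoly (j + 1)).coeff 0 = 0 := by
  induction j with
  | zero => simp [binomPoly]
  | succ j ih =>
    rw [binomPoly, mul_coeff_zero, mul_coeff_zero, ih]
    simp

/-- These are the coefficients of the logarithm series, which is why the logarithm is the linear
coefficient of `S ^ t`. -/
theorem binomPoly_coeff_one (j : ℕ) :
    (binomPoly (j + 1)).coeff 1 = (-1) ^ j / (j + 1 : ℕ) := by
  induction j with
  | zero => simp [binomPoly]
  | succ j ih =>
    rw [binomPoly, coeff_mul_C, mul_sub, coeff_sub, coeff_mul_X, coeff_mul_C, ih,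
      binomPoly_coeff_zero, pow_succ]
    push_cast
    field_simp
    ring

variable {k : Type*} [CommRing k] {R : Type*} [CommRing R] [Algebra k R] [Algebra ℚ R]

/-- The powers `S ^ t` of a series with constant term `1`, as polynomials in the exponent `t`. -/
def powSeries (S : NCSeries R) : NCSeries R[X] := fun w =>
  ∑ j ∈ Finset.range (w.length + 1), C (((S - 1) ^ j) w) * (binomPoly j).map (algebraMap ℚ R)

/-- This is the binomial theorem for `1 + (S - 1)`. The two truncations agree: terms with `j > n`
have zero binomial coefficient, and terms with `j > |w|` vanish because `S - 1` has no constant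
term. -/
theorem powSeries_eval {S : NCSeries R} (h : S [] = 1) (n : ℕ) (w : Word) :
    (powSeries S w).eval (n : R) = (S ^ n) w := by
  have hB : ∀ j, ((binomPoly j).map (algebraMap ℚ R)).eval (n : R) = n.choose j := fun j => by
    have : (n : R) = algebraMap ℚ R n := by simp
    rw [this, eval_map_algebraMap, aeval_algebraMap_apply, coe_aeval_eq_eval, binomPoly_eval]
    simp
  have hS : S ^ n = ∑ j ∈ Finset.range (n + 1), (S - 1) ^ j * (n.choose j : NCSeries R) := by
    have := (Commute.one_right (S - 1)).add_pow n
    simpa using this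
  have hc : ∀ (T : NCSeries R) (m : ℕ), (T * (m : NCSeries R)) w = T w * m := fun T m => by
    induction m with
    | zero => simp; rfl
    | succ m ih => push_cast; rw [mul_add, mul_add, NCSeries.add_apply, ih, mul_one, mul_one]
  rw [powSeries, eval_finsetSum, hS, NCSeries.sum_apply]
  simp only [eval_mul, eval_C, hB, hc]
  rw [Finset.sum_subset (Finset.range_mono (Nat.le_add_right (w.length + 1) (n + 1))),
    ← Finset.sum_subset (Finset.range_mono (Nat.le_add_left (n + 1) (w.length + 1)))]
  · intro j _ hj
    rw [Nat.choose_eq_zero_of_lt (by simpa using hj)]; simp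
  · intro j _ hj
    rw [NCSeries.pow_apply_eq_zero _ (NCSeries.sub_one_nil h), zero_mul]
    simpa using hj

theorem powSeries_coeff_zero (S : NCSeries R) (w : Word) :
    (powSeries S w).coeff 0 = (1 : NCSeries R) w := by
  rw [powSeries, finsetSum_coeff, Finset.sum_range_succ']
  simp only [coeff_C_mul, coeff_map, binomPoly_coeff_zero, map_zero, mul_zero,
    Finset.sum_const_zero, zero_add, pow_zero]
  simp only [binomPoly, coeff_one_zero, map_one, mul_one]

theorem powSeries_coeff_one (S : NCSeries R) (w : Word) :
    (powSeries S w).coeff 1 = NCSeries.log S w := by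
  rw [powSeries, finsetSum_coeff, Finset.sum_range_succ', NCSeries.log,
    ← Finset.Ico_add_one_right_eq_Icc, Finset.sum_Ico_eq_sum_range]
  simp only [coeff_C_mul, coeff_map, binomPoly_coeff_one, add_tsub_cancel_right,
    Algebra.smul_def, add_comm 1]
  simp [binomPoly, coeff_one, mul_comm]

variable (k) in
/-- A series is primitive if it is a derivation along the counit. -/
def IsPrim (S : NCSeries R) : Prop :=
  ∀ u v, evalS k S (M k u * M k v) = S u * (1 : NCSeries R) v + (1 : NCSeries R) u * S v

/-- The logarithm of a character is primitive. -/
theorem IsChar.log {S : NCSeries R} (hS : IsChar k S) : IsPrim k (NCSeries.log S) := by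
  have hev : ∀ n : ℕ, ((leval (n : R)).restrictScalars k) ∘ₗ evalS k (powSeries S)
      = evalS k (S ^ n) := fun n => by
    rw [comp_evalS]
    congr 1
    funext w
    exact powSeries_eval hS.1 n w
  have hco : ((lcoeff R 1).restrictScalars k) ∘ₗ evalS k (powSeries S)
      = evalS k (NCSeries.log S) := by
    rw [comp_evalS]
    congr 1
    funext w
    exact powSeries_coeff_one S w
  intro u v
  -- Both sides are polynomials in the exponent which agree at every natural number `n`, as `S ^ n`
  -- is a character.
  have key : evalS k (powSeries S) (M k u * M k v) = powSeries S u * powSeries S v := by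
    rw [← sub_eq_zero]
    refine polynomial_eq_zero_of_eval_natCast _ _ le_rfl fun n => ?_
    have h1 := LinearMap.congr_fun (hev n) (M k u * M k v)
    rw [(hS.pow n).2] at h1
    rw [eval_sub, eval_mul, powSeries_eval hS.1, powSeries_eval hS.1, ← h1, sub_eq_zero]
    rfl
  have h2 := LinearMap.congr_fun hco (M k u * M k v)
  rw [← h2, LinearMap.comp_apply, key]
  change (powSeries S u * powSeries S v).coeff 1 = _
  -- The linear coefficient of a product pairs a linear coefficient, the logarithm, with a constant
  -- one, the counit.
  rw [coeff_mul, Finset.Nat.antidiagonal_succ]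
  simp [powSeries_coeff_zero, powSeries_coeff_one]
  ring

end Polynomial

theorem isPrimitive_log_genM (k : Type*) [CommRing k] [Algebra ℚ k] :
    IsPrimitive k (NCSeries.log (genM k)) := by
  have h : IsChar k (genM k) :=
    ⟨isGroupLike_genM.1, fun u v => by rw [← coprodSeries_eq, isGroupLike_genM.2]⟩
  intro u v
  rw [coprodSeries_eq, h.log]

/-! ### The weight -/

theorem weight_append (u v : Word) : weight (u ++ v) = weight u + weight v := by
  simp [weight]

theorem weight_cons (a : ℕ+) (v : Word) : weight (a :: v) = a + weight v := by
  simp [weight]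

theorem weight_nil : weight [] = 0 := rfl

theorem length_le_weight (w : Word) : w.length ≤ weight w := by
  induction w with
  | nil => simp
  | cons a w ih =>
    rw [weight_cons, List.length_cons]
    have := a.pos
    omega

theorem weight_pos {w : Word} (h : w ≠ []) : 0 < weight w :=
  (List.length_pos_iff.2 h).trans_le (length_le_weight w)

section

variable {k : Type*} [CommRing k]

theorem QSym.eq_sum_coord (x : QSym k) :
    x = ∑ w ∈ Finsupp.support (x : Word →₀ k), coord w x • M k w := by
  have h : ∀ f : Word →₀ k, f = ∑ w ∈ f.support, f w • Finsupp.single w 1 := fun f => by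
    conv_lhs => rw [← Finsupp.sum_single f]
    simp [Finsupp.sum]
  exact h x

variable (k) in
/-- Quasi-symmetric functions which are homogeneous of a given weight. -/
def homog (n : ℕ) : Submodule k (QSym k) where
  carrier := {x | ∀ w, weight w ≠ n → coord w x = 0}
  add_mem' hx hy w hw := by rw [map_add, hx w hw, hy w hw, add_zero]
  zero_mem' w _ := map_zero _
  smul_mem' c x hx w hw := by rw [map_smul, hx w hw, smul_zero]

theorem M_mem_homog (w : Word) : M k w ∈ homog k (weight w) := fun u hu => by
  rw [coord_M, if_neg]
  rintro rfl
  exact hu rfl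

theorem pre_mem_homog (a : ℕ+) {n : ℕ} {x : QSym k} (hx : x ∈ homog k n) :
    pre a x ∈ homog k (a + n) := by
  rintro (_ | ⟨b, w⟩) hw
  · have : coord [] ∘ₗ pre a = (0 : QSym k →ₗ[k] k) :=
      QSym.hom_ext fun u => by simp [pre_M, coord_M]
    exact LinearMap.congr_fun this x
  · rw [coord_cons_pre]
    split_ifs with h
    · subst h
      refine hx w fun h => hw ?_
      rw [weight_cons, h]
    · rfl

/-- All three terms of the recursion have the same weight, the contracted letter being the sum of
the two indices. -/
theorem M_mul_M_mem_homog (u v : Word) : M k u * M k v ∈ homog k (weight u + weight v) := by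
  induction u, v using stuffle.induct with
  | case1 w => simpa [M_nil, weight_nil] using M_mem_homog w
  | case2 i u => simpa [M_nil, weight_nil] using M_mem_homog (i :: u)
  | case3 i u j v h1 h2 h3 =>
    rw [M_cons_mul_M_cons]
    refine add_mem (add_mem ?_ ?_) ?_
    · convert pre_mem_homog j h1 using 2
      simp only [weight_cons]; omega
    · convert pre_mem_homog i h2 using 2
      simp only [weight_cons]; omega
    · convert pre_mem_homog (i + j) h3 using 2
      simp only [weight_cons, PNat.add_coe]; omega

theorem M_mul_mem_homog (u : Word) {n : ℕ} {y : QSym k} (hy : y ∈ homog k n) :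
    M k u * y ∈ homog k (weight u + n) := by
  rw [eq_sum_coord y, Finset.mul_sum]
  refine sum_mem fun w _ => ?_
  rw [mul_smul_comm]
  by_cases hw : weight w = n
  · subst hw
    exact Submodule.smul_mem _ _ (M_mul_M_mem_homog u w)
  · rw [hy w hw, zero_smul]
    exact zero_mem _

theorem prod_map_M_mem_homog (L : List Word) : (L.map (M k)).prod ∈ homog k (weight L.flatten) := by
  induction L with
  | nil => exact M_mem_homog []
  | cons u L ih =>
    rw [List.map_cons, List.prod_cons, List.flatten_cons, weight_append]
    exact M_mul_mem_homog u ih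

theorem coord_prod_map_M (L : List Word) (w : Word) :
    coord w (L.map (M k)).prod = stuffleList k L w := by
  have : (L.map (M k)).prod = stuffleList k L := by
    induction L with
    | nil => rfl
    | cons u L ih => rw [List.map_cons, List.prod_cons, ih]; rfl
  rw [this]
  rfl

/-- A word has at most one cut with prescribed pieces; this converts sums over cuts into sums over
pairs of words. -/
theorem sum_ite_take_drop {A : Type*} [AddCommMonoid A] (v a x : Word) (c : A) :
    (∑ i ∈ Finset.range (v.length + 1), if v.take i = a ∧ v.drop i = x then c else 0) =
      if a ++ x = v then c else 0 := by
  by_cases h : a ++ x = v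
  · subst h
    rw [if_pos rfl, Finset.sum_eq_single a.length]
    · simp
    · intro i hi hne
      rw [if_neg]
      rintro ⟨h1, -⟩
      refine hne ?_
      have := congrArg List.length h1
      rw [List.length_take] at this
      have := Finset.mem_range.1 hi
      omega
    · intro hi
      simp at hi
  · rw [if_neg h]
    refine Finset.sum_eq_zero fun i _ => if_neg ?_
    rintro ⟨rfl, rfl⟩
    exact h (List.take_append_drop i v)

/-! ### The logarithm of the generating series -/

theorem genM_sub_one_apply (w : Word) : (genM k - 1) w = if w = [] then 0 else M k w := by
  change genM k w - (1 : NCSeries (QSym k)) w = _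
  rw [genM_apply, NCSeries.one_apply]
  split_ifs with h
  · rw [h, M_nil, sub_self]
  · rw [sub_zero]

theorem weight_take_le (v : Word) (i : ℕ) : weight (v.take i) ≤ weight v := by
  conv_rhs => rw [← List.take_append_drop i v, weight_append]
  omega

theorem weight_drop_le (v : Word) (i : ℕ) : weight (v.drop i) ≤ weight v := by
  conv_rhs => rw [← List.take_append_drop i v, weight_append]
  omega

/-- The bound `N` is independent of `v` so that the induction hypothesis applies to the suffixes of
`v` with the same index set. -/
theorem genM_sub_one_pow_apply (N r : ℕ) : ∀ v : Word, weight v ≤ N →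
    ((genM k - 1) ^ r) v =
      ∑ u ∈ Fintype.piFinset fun _ : Fin r => (wordsOfWeightLE N).filter (· ≠ []),
        if (List.ofFn u).flatten = v then ((List.ofFn u).map (M k)).prod else 0 := by
  induction r with
  | zero =>
    intro v _
    simp [NCSeries.one_apply, eq_comm]
  | succ r ih =>
    intro v hv
    set W := (wordsOfWeightLE N).filter (· ≠ []) with hW
    have e : ∀ f : (Fin (r + 1) → Word) → QSym k,
        ∑ u ∈ Fintype.piFinset fun _ : Fin (r + 1) => W, f u =
          ∑ a ∈ W, ∑ u ∈ Fintype.piFinset fun _ : Fin r => W, f (Fin.cons a u) := fun f => by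
      rw [← Finset.sum_product']
      refine (Finset.sum_nbij' (fun p => Fin.cons p.1 p.2) (fun u => (u 0, Fin.tail u))
        ?_ ?_ ?_ ?_ ?_).symm
      · rintro ⟨a, u⟩ h
        rw [Finset.mem_product, Fintype.mem_piFinset] at h
        rw [Fintype.mem_piFinset]
        exact Fin.cases h.1 h.2
      · intro u h
        rw [Fintype.mem_piFinset] at h
        rw [Finset.mem_product, Fintype.mem_piFinset]
        exact ⟨h 0, fun i => h i.succ⟩
      · rintro ⟨a, u⟩ _
        simp
      · intro u _
        simp
      · intro _ _
        rfl
    have hS : ∀ i, (genM k - 1) (v.take i) = ∑ a ∈ W, if v.take i = a then M k a else 0 := by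
      intro i
      rw [Finset.sum_ite_eq, genM_sub_one_apply]
      have : v.take i ∈ W ↔ v.take i ≠ [] := by
        rw [hW, Finset.mem_filter, mem_wordsOfWeightLE]
        exact ⟨fun h => h.2, fun h => ⟨(weight_take_le v i).trans hv, h⟩⟩
      simp only [this, ite_not]
    rw [pow_succ', NCSeries.mul_apply, e]
    simp only [hS, Finset.sum_mul, List.ofFn_succ, Fin.cons_zero, Fin.cons_succ,
      List.flatten_cons, List.map_cons, List.prod_cons]
    rw [Finset.sum_comm]
    refine Finset.sum_congr rfl fun a _ => ?_
    simp only [fun i => ih (v.drop i) ((weight_drop_le v i).trans hv), Finset.mul_sum]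
    rw [Finset.sum_comm]
    refine Finset.sum_congr rfl fun u _ => ?_
    rw [← sum_ite_take_drop]
    refine Finset.sum_congr rfl fun i _ => ?_
    rw [ite_and, ite_mul, zero_mul]
    refine if_congr Iff.rfl ?_ rfl
    rw [mul_ite, mul_zero]
    exact if_congr eq_comm rfl rfl

theorem genM_sub_one_pow_mem_homog (r : ℕ) (v : Word) :
    ((genM k - 1) ^ r) v ∈ homog k (weight v) := by
  rw [genM_sub_one_pow_apply _ r v le_rfl]
  refine sum_mem fun u _ => ?_
  split_ifs with h
  · rw [← h]; exact prod_map_M_mem_homog _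
  · exact zero_mem _

variable [Algebra ℚ k]

theorem coord_log_genM (v w : Word) : coord w (NCSeries.log (genM k) v) =
    ∑ n ∈ Finset.Icc 1 v.length, ((-1 : ℚ) ^ (n - 1) / n) • coord w (((genM k - 1) ^ n) v) := by
  rw [NCSeries.log, map_sum]
  exact Finset.sum_congr rfl fun n _ => map_rat_smul _ _ _

theorem log_genM_mem_homog (v : Word) : NCSeries.log (genM k) v ∈ homog k (weight v) :=
  fun w hw => by
    rw [coord_log_genM]
    refine Finset.sum_eq_zero fun n _ => ?_
    rw [genM_sub_one_pow_mem_homog n v w hw, smul_zero]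

/-- `π₁` is the adjoint of the logarithm: both sides come from the expansion of the powers of `genM
k - 1`, and homogeneity reconciles their different truncations. -/
theorem coeffL_piOne (v w : Word) :
    coeffL k v (piOne k w) = coord w (NCSeries.log (genM k) v) := by
  rw [piOne]
  split_ifs with hw
  · subst hw
    rw [map_zero]
    by_cases hv : v = []
    · subst hv
      simp [coord_log_genM]
    · exact (log_genM_mem_homog v [] (weight_pos hv).ne).symm
  · rw [map_add, map_sum, coeffL_word]
    simp only [map_rat_smul, map_sum, map_smul, coeffL_word, smul_eq_mul, mul_ite, mul_one,
      mul_zero]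
    by_cases h : weight w = weight v
    · have hv : v ≠ [] := by
        rintro rfl
        exact (weight_pos hw).ne' h
      have hpos := weight_pos hv
      -- The logarithm sum is extended from `|v|` to `weight v`, which adds only zero terms; its
      -- term of index one is the isolated word `w` in the definition of `π₁(w)`.
      rw [coord_log_genM, Finset.sum_subset
        (Finset.Icc_subset_Icc_right (length_le_weight v)), h,
        ← Finset.insert_Icc_add_one_left_eq_Icc (by omega : 1 ≤ weight v),
        Finset.sum_insert (by simp)]
      · congr 1
        · simp [genM_sub_one_apply, hv, coord_M, eq_comm]
        · refine Finset.sum_congr rfl fun r _ => ?_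
          rw [genM_sub_one_pow_apply (weight v) r v le_rfl, map_sum]
          congr 1
          refine Finset.sum_congr rfl fun u _ => ?_
          split_ifs
          · rw [coord_prod_map_M]
          · rw [map_zero]
      · intro n _ hn
        rw [NCSeries.pow_apply_eq_zero, map_zero, smul_zero]
        · rw [genM_sub_one_apply, if_pos rfl]
        · simp only [Finset.mem_Icc] at *
          omega
    · rw [log_genM_mem_homog v w h, if_neg (fun h' => h (by rw [h'])), zero_add]
      refine Finset.sum_eq_zero fun r _ => ?_
      rw [Finset.sum_eq_zero, smul_zero]
      intro u _
      split_ifs with h2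
      · rw [← coord_prod_map_M]
        refine prod_map_M_mem_homog _ _ ?_
        rwa [h2]
      · rfl

/-- At a fixed word `v`, the sum is the finite expansion of the coefficient of `v` in the basis `M k
w`. -/
theorem isSum_log_genM : NCSeries.IsSum
    (fun w => scaled k (toQSym k (word k w)) (piOne k w)) (NCSeries.log (genM k)) := by
  intro v
  have hw : ∀ w, scaled k (toQSym k (word k w)) (piOne k w) v =
      coord w (NCSeries.log (genM k) v) • M k w := fun w => by
    rw [scaled, coeffL_piOne]
    exact congrArg _ (genM_apply w)
  simp only [hw]
  set x := NCSeries.log (genM k) v with hx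
  have hsub : (Function.support fun w => coord w x • M k w) ⊆ Finsupp.support (x : Word →₀ k) := by
    intro w hw
    by_contra h0
    refine hw ?_
    have h1 : coord w x = 0 := Finsupp.notMem_support_iff.1 h0
    change coord w x • M k w = 0
    rw [h1, zero_smul]
  refine ⟨(Finset.finite_toSet _).subset hsub, ?_⟩
  rw [finsum_eq_sum_of_support_subset _ hsub]
  exact eq_sum_coord x

end

section

variable {k : Type*} [CommRing k]

/-! ### Primitive series and derivations -/

/-- The adjoint of the left multiplication by a series. -/
def lderiv (S : NCSeries k) : QSym k →ₗ[k] QSym k :=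
  evalS k (R := QSym k) fun u => ∑ i ∈ Finset.range (u.length + 1), S (u.take i) • M k (u.drop i)

theorem lderiv_M (S : NCSeries k) (u : Word) : lderiv S (M k u) =
    ∑ i ∈ Finset.range (u.length + 1), S (u.take i) • M k (u.drop i) :=
  evalS_M _ _

theorem evalS_mul (S T : NCSeries k) (x : QSym k) :
    evalS k (S * T) x = evalS k T (lderiv S x) := by
  have : evalS k (S * T) = evalS k T ∘ₗ lderiv S :=
    hom_ext fun u => by
      simp only [LinearMap.comp_apply, lderiv_M, map_sum, map_smul, evalS_M, smul_eq_mul,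
        NCSeries.mul_apply]
  exact LinearMap.congr_fun this x

theorem eq_of_forall_evalS {x y : QSym k} (h : ∀ T : NCSeries k, evalS k T x = evalS k T y) :
    x = y := by
  refine ext_coord fun w => ?_
  have hw : evalS k (R := k) (fun u => if u = w then 1 else 0) = coord w :=
    hom_ext fun u => by rw [coord_M]; exact evalS_M _ _
  rw [← hw]
  exact h _

theorem sum_one_take_mul (v : Word) (f : ℕ → k) :
    ∑ q ∈ Finset.range (v.length + 1), (1 : NCSeries k) (v.take q) * f q = f 0 := by
  rw [Finset.sum_range_succ', Finset.sum_eq_zero]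
  · simp [NCSeries.one_apply]
  · intro q hq
    rw [NCSeries.one_apply, if_neg, zero_mul]
    intro h
    have h1 := congrArg List.length h
    have h2 := Finset.mem_range.1 hq
    rw [List.length_take, List.length_nil] at h1
    omega

/-- Against a test series `T`, the value of `S * T` on the product is a sum over pairs of cuts;
primitivity of `S` kills those where both left pieces are nonempty. -/
theorem IsPrim.lderiv_M_mul_M {S : NCSeries k} (hS : IsPrim k S) (u v : Word) :
    lderiv S (M k u * M k v) = lderiv S (M k u) * M k v + M k u * lderiv S (M k v) := by
  refine eq_of_forall_evalS fun T => ?_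
  rw [← evalS_mul, evalS_mul_M_mul_M]
  simp only [hS _ _, add_mul, Finset.sum_add_distrib, mul_assoc, ← Finset.mul_sum]
  simp only [sum_one_take_mul, Finset.mul_sum, lderiv_M, Finset.sum_mul,
    smul_mul_assoc, mul_smul_comm, map_add, map_sum, map_smul, smul_eq_mul, List.drop_zero]
  congr 1
  rw [Finset.sum_comm]
  refine Finset.sum_congr rfl fun q _ => ?_
  exact sum_one_take_mul u
    (fun p => S (v.take q) * evalS k T (M k (u.drop p) * M k (v.drop q)))

theorem eq_of_forall_M_mul_M {N : Type*} [AddCommGroup N] [Module k N]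
    {f g : QSym k →ₗ[k] QSym k →ₗ[k] N} (h : ∀ u v, f (M k u) (M k v) = g (M k u) (M k v))
    (x y : QSym k) : f x y = g x y := by
  have : f = g := hom_ext fun u => hom_ext fun v => h u v
  rw [this]

/-- The adjoint of the left multiplication by a primitive series is a derivation. -/
theorem IsPrim.lderiv_mul {S : NCSeries k} (hS : IsPrim k S) (x y : QSym k) :
    lderiv S (x * y) = lderiv S x * y + x * lderiv S y :=
  eq_of_forall_M_mul_M (f := (LinearMap.mul k (QSym k)).compr₂ (lderiv S))
    (g := (LinearMap.mul k (QSym k)) ∘ₗ lderiv S + (LinearMap.mul k (QSym k)).compl₂ (lderiv S))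
    hS.lderiv_M_mul_M x y

theorem evalS_one_lderiv (S : NCSeries k) (x : QSym k) :
    evalS k (1 : NCSeries k) (lderiv S x) = evalS k S x := by
  rw [← evalS_mul, mul_one]

theorem evalS_one_mul (x y : QSym k) :
    evalS k (1 : NCSeries k) (x * y) = evalS k (1 : NCSeries k) x * evalS k (1 : NCSeries k) y :=
  (isChar_one (k := k) (R := k)).evalS_mul x y

theorem IsPrim.evalS_mul {S : NCSeries k} (hS : IsPrim k S) (x y : QSym k) :
    evalS k S (x * y) = evalS k S x * evalS k (1 : NCSeries k) y
      + evalS k (1 : NCSeries k) x * evalS k S y := by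
  simp only [← evalS_one_lderiv S, hS.lderiv_mul, map_add, evalS_one_mul]

theorem evalS_sub (S T : NCSeries k) (x : QSym k) :
    evalS k (S - T) x = evalS k S x - evalS k T x := by
  have : evalS k (S - T) = evalS k S - evalS k T :=
    hom_ext fun w => by simp only [evalS_M, LinearMap.sub_apply]; rfl
  rw [this, LinearMap.sub_apply]

/-- Applied to a product, `S * T` has the cross terms `S u * T v + T u * S v`, symmetric in `S` and
`T`, so they cancel in the bracket. -/
theorem IsPrim.bracket {S T : NCSeries k} (hS : IsPrim k S) (hT : IsPrim k T) :
    IsPrim k (S * T - T * S) := by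
  have key : ∀ {S T : NCSeries k}, IsPrim k S → IsPrim k T → ∀ u v,
      evalS k (S * T) (M k u * M k v) = (S * T) u * (1 : NCSeries k) v + S u * T v + T u * S v
        + (1 : NCSeries k) u * (S * T) v := by
    intro S T hS hT u v
    rw [Quasi.evalS_mul, hS.lderiv_mul, map_add, hT.evalS_mul, hT.evalS_mul,
      evalS_one_lderiv, evalS_one_lderiv, ← Quasi.evalS_mul, ← Quasi.evalS_mul]
    simp only [evalS_M]
    ring
  intro u v
  rw [evalS_sub, key hS hT, key hT hS]
  change _ = ((S * T) u - (T * S) u) * _ + _ * ((S * T) v - (T * S) v)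
  ring

/-! ### Polynomials as series -/

/-- A polynomial as a series. -/
def ser (P : NCPoly k) : NCSeries k := fun w => coeffL k w P

theorem ser_word (u w : Word) : ser (word k u) w = if u = w then 1 else 0 := coeffL_word w u

theorem ser_one : ser (1 : NCPoly k) = 1 := by
  funext w
  rw [← word_nil, ser_word, NCSeries.one_apply]
  exact if_congr eq_comm rfl rfl

theorem ser_sub (P Q : NCPoly k) : ser (P - Q) = ser P - ser Q := by
  funext w
  exact map_sub (coeffL k w) P Q

theorem ser_mul (P Q : NCPoly k) : ser (P * Q) = ser P * ser Q := by
  funext w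
  have h : (LinearMap.mul k (NCPoly k)).compr₂ (coeffL k w) =
      ∑ i ∈ Finset.range (w.length + 1),
        (LinearMap.mul k k).compl₁₂ (coeffL k (w.take i)) (coeffL k (w.drop i)) := by
    refine NCPoly.hom_ext fun u => NCPoly.hom_ext fun v => ?_
    simp only [LinearMap.compr₂_apply, LinearMap.mul_apply', word_mul_word, coeffL_word,
      LinearMap.sum_apply, LinearMap.compl₁₂_apply, mul_ite, mul_one, mul_zero]
    rw [← sum_ite_take_drop]
    refine Finset.sum_congr rfl fun i _ => ?_
    by_cases h1 : u = w.take i <;> by_cases h2 : v = w.drop i <;>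
      simp [h1, h2, eq_comm]
  have h2 := LinearMap.congr_fun₂ h P Q
  simp only [LinearMap.compr₂_apply, LinearMap.mul_apply', LinearMap.sum_apply,
    LinearMap.compl₁₂_apply] at h2
  exact h2

theorem ser_list_prod (L : List (NCPoly k)) : ser L.prod = (L.map ser).prod := by
  induction L with
  | nil => exact ser_one
  | cons P L ih => rw [List.prod_cons, ser_mul, ih, List.map_cons, List.prod_cons]

theorem coord_toQSym (w : Word) (P : NCPoly k) : coord w (toQSym k P) = coeffL k w P := by
  have : coord w ∘ₗ toQSym k = coeffL k w :=
    NCPoly.hom_ext fun u => by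
      rw [coeffL_word, LinearMap.comp_apply]
      rw [show toQSym k (word k u) = M k u from genM_apply u, coord_M]
  exact LinearMap.congr_fun this P

theorem toQSym_injective : Function.Injective (toQSym k) := by
  intro P Q h
  refine MonoidAlgebra.coeff_injective (Finsupp.ext fun w => ?_)
  have := congrArg (coord (FreeMonoid.toList w)) h
  rwa [coord_toQSym, coord_toQSym] at this

theorem toQSym_surjective : Function.Surjective (toQSym k) := by
  intro x
  refine ⟨∑ w ∈ Finsupp.support (x : Word →₀ k), coord w x • word k w, ?_⟩
  conv_rhs => rw [eq_sum_coord x]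
  rw [map_sum]
  refine Finset.sum_congr rfl fun w _ => ?_
  rw [map_smul]
  exact congrArg _ (genM_apply w)

theorem pairing_eq (P Q : NCPoly k) : pairing k P Q = evalS k (ser P) (toQSym k Q) := by
  rw [evalS_eq_finsum,
    finsum_eq_sum_of_support_subset (s := P.coeff.support.map FreeMonoid.toList.toEmbedding)]
  · rw [Finset.sum_map, pairing, Finsupp.sum]
    refine Finset.sum_congr rfl fun w _ => ?_
    rw [coord_toQSym, smul_eq_mul, mul_comm]
    rfl
  · intro w hw
    rw [Finset.mem_coe, Finset.mem_map]
    refine ⟨FreeMonoid.ofList w, ?_, rfl⟩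
    rw [Finsupp.mem_support_iff]
    intro h
    refine hw ?_
    have h0 : ser P w = 0 := h
    change _ • ser P w = 0
    rw [h0, smul_zero]

/-! ### Homogeneous series and leading words -/

/-- Series which are homogeneous of a given weight. -/
def IsHomog (S : NCSeries k) (n : ℕ) : Prop := ∀ w, weight w ≠ n → S w = 0

theorem IsHomog.mul {S T : NCSeries k} {m n : ℕ} (hS : IsHomog S m) (hT : IsHomog T n) :
    IsHomog (S * T) (m + n) := by
  intro w hw
  rw [NCSeries.mul_apply]
  refine Finset.sum_eq_zero fun i _ => ?_
  by_cases h : weight (w.take i) = m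
  · rw [hT, mul_zero]
    intro h'
    refine hw ?_
    rw [← List.take_append_drop i w, weight_append, h, h']
  · rw [hS _ h, zero_mul]

theorem IsHomog.sub {S T : NCSeries k} {n : ℕ} (hS : IsHomog S n) (hT : IsHomog T n) :
    IsHomog (S - T) n := by
  intro w hw
  change S w - T w = 0
  rw [hS w hw, hT w hw, sub_zero]

theorem isHomog_one : IsHomog (1 : NCSeries k) 0 := by
  intro w hw
  rw [NCSeries.one_apply, if_neg]
  rintro rfl
  exact hw rfl

/-- Words ordered by length, then lexicographically. -/
def Prec (u v : Word) : Prop := u.length < v.length ∨ u.length = v.length ∧ WordLT u v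

theorem Prec.trans {u v w : Word} (h : Prec u v) (h' : Prec v w) : Prec u w := by
  rcases h with h | ⟨h1, h2⟩ <;> rcases h' with h' | ⟨h1', h2'⟩
  · exact Or.inl (h.trans h')
  · exact Or.inl (h1' ▸ h)
  · exact Or.inl (h1 ▸ h')
  · exact Or.inr ⟨h1.trans h1', h2.trans h2'⟩

theorem prec_irrefl (u : Word) : ¬ Prec u u := by
  rintro (h | ⟨-, h⟩)
  · exact lt_irrefl _ h
  · exact wordLT_irrefl u h

theorem prec_trichotomy (u v : Word) : Prec u v ∨ u = v ∨ Prec v u := by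
  rcases lt_trichotomy u.length v.length with h | h | h
  · exact Or.inl (Or.inl h)
  · rcases wordLT_trichotomy u v with h' | h' | h'
    · exact Or.inl (Or.inr ⟨h, h'⟩)
    · exact Or.inr (Or.inl h')
    · exact Or.inr (Or.inr (Or.inr ⟨h.symm, h'⟩))
  · exact Or.inr (Or.inr (Or.inl h))

/-- The smallest word of the series is `u`, with coefficient `1`. -/
def HasLead (S : NCSeries k) (u : Word) : Prop := S u = 1 ∧ ∀ v, Prec v u → S v = 0

theorem hasLead_one : HasLead (1 : NCSeries k) [] := by
  refine ⟨rfl, fun v hv => ?_⟩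
  rcases hv with hv | ⟨-, hv⟩
  · simp at hv
  · exact absurd hv (not_wordLT_nil v)

/-- Because length is compared first, a cut of a word of length at most `|u| + |v|` either leaves
one piece too short or has lengths exactly `|u|` and `|v|`; in the latter case the lexicographic
comparison decides. -/
theorem HasLead.mul {S T : NCSeries k} {u v : Word} (hS : HasLead S u) (hT : HasLead T v) :
    HasLead (S * T) (u ++ v) := by
  constructor
  · rw [NCSeries.mul_apply, Finset.sum_eq_single u.length]
    · simp [hS.1, hT.1]
    · intro i hi hne
      have hi := Finset.mem_range.1 hi
      rw [List.length_append] at hi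
      rcases lt_or_gt_of_ne hne with h | h
      · rw [hS.2, zero_mul]
        refine Or.inl ?_
        rw [List.length_take]
        omega
      · rw [hT.2, mul_zero]
        refine Or.inl ?_
        rw [List.length_drop, List.length_append]
        omega
    · intro h
      simp at h
  · intro x hx
    rw [NCSeries.mul_apply]
    refine Finset.sum_eq_zero fun i hi => ?_
    have hi := Finset.mem_range.1 hi
    have h1 : (x.take i).length = i := by rw [List.length_take]; omega
    have h2 : (x.drop i).length = x.length - i := List.length_drop
    by_cases hu : Prec (x.take i) u
    · rw [hS.2 _ hu, zero_mul]
    by_cases hv : Prec (x.drop i) v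
    · rw [hT.2 _ hv, mul_zero]
    exfalso
    simp only [Prec, not_or, not_and, not_lt] at hu hv
    rcases hx with hx | ⟨hx, hlt⟩
    · rw [List.length_append] at hx
      omega
    · rw [List.length_append] at hx
      have hiu : (x.take i).length = u.length := by omega
      have hiv : (x.drop i).length = v.length := by omega
      have hu := hu.2 hiu
      have hv := hv.2 hiv
      rw [← List.take_append_drop i x] at hlt
      rcases wordLT_trichotomy (x.take i) u with h | h | h
      · exact hu h
      · rw [h, append_wordLT_append_left_iff] at hlt
        exact hv hlt
      · exact (h.append_of_length_le hiu.le _ _).asymm hlt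

theorem HasLead.sub {S T : NCSeries k} {u v : Word} (hS : HasLead S u) (hT : HasLead T v)
    (h : Prec u v) : HasLead (S - T) u := by
  constructor
  · change S u - T u = 1
    rw [hS.1, hT.2 u h, sub_zero]
  · intro w hw
    change S w - T w = 0
    rw [hS.2 w hw, hT.2 w (hw.trans h), sub_zero]

variable [Algebra ℚ k]

/-! ### The polynomials attached to Lyndon words -/

theorem ser_piOne_apply (w v : Word) :
    ser (piOne k w) v = coord w (NCSeries.log (genM k) v) := coeffL_piOne v w

/-- The series of `π₁(w)` is the coordinate at `w` of the logarithm of the generating series, and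
primitivity passes to coordinates. -/
theorem isPrim_piOne (w : Word) : IsPrim k (ser (piOne k w)) := by
  intro u v
  have h1 : coord w ∘ₗ evalS k (NCSeries.log (genM k)) = evalS k (ser (piOne k w)) := by
    rw [comp_evalS]
    congr 1
    funext v
    exact (ser_piOne_apply w v).symm
  have h2 := isPrimitive_log_genM k u v
  rw [coprodSeries_eq] at h2
  rw [← h1, LinearMap.comp_apply, h2, ser_piOne_apply, ser_piOne_apply]
  simp only [NCSeries.one_apply, map_add]
  split_ifs <;> simp

theorem isHomog_piOne (w : Word) : IsHomog (ser (piOne k w)) (weight w) := by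
  intro v hv
  rw [ser_piOne_apply]
  exact log_genM_mem_homog v w hv.symm

/-- Besides `y_a`, only words with at least two letters occur in `π₁(y_a)`; this is why `Prec`
compares lengths before the lexicographic order. -/
theorem hasLead_piOne (a : ℕ+) : HasLead (ser (piOne k [a])) [a] := by
  have h : ∀ b, ser (piOne k [a]) [b] = if b = a then 1 else 0 := fun b => by
    rw [ser_piOne_apply, coord_log_genM]
    simp [genM_sub_one_apply, coord_M]
  refine ⟨by rw [h, if_pos rfl], fun v hv => ?_⟩
  rcases v with _ | ⟨b, _ | ⟨c, v⟩⟩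
  · exact isHomog_piOne _ _ (weight_pos (List.cons_ne_nil a [])).ne
  · rw [h, if_neg]
    rintro rfl
    exact prec_irrefl _ hv
  · simp [Prec] at hv

theorem ser_lyndonPi_of_two_le {l : Word} (h : 2 ≤ l.length) :
    ser (lyndonPi k l) =
      ser (lyndonPi k (l.take (stdCut l h))) * ser (lyndonPi k (l.drop (stdCut l h)))
      - ser (lyndonPi k (l.drop (stdCut l h))) * ser (lyndonPi k (l.take (stdCut l h))) := by
  rcases l with _ | ⟨a, _ | ⟨b, t⟩⟩
  · simp at h
  · simp at h
  · conv_lhs => rw [lyndonPi]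
    rw [Ring.lie_def, ser_sub, ser_mul, ser_mul]

theorem isPrim_lyndonPi (n : ℕ) : ∀ l : Word, l.length ≤ n → IsPrim k (ser (lyndonPi k l)) := by
  have h0 : IsPrim k (ser (lyndonPi k [])) := fun u v => by
    have : ser (lyndonPi k []) = 0 := by
      rw [lyndonPi]
      funext w
      exact map_zero (coeffL k w)
    rw [this, evalS_zero]
    change 0 = 0 * _ + _ * 0
    simp
  induction n with
  | zero =>
    intro l hl
    rw [List.length_eq_zero_iff.1 (Nat.le_zero.1 hl)]
    exact h0
  | succ n ih =>
    intro l hl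
    by_cases h2 : 2 ≤ l.length
    · have := stdCut_spec l h2
      rw [ser_lyndonPi_of_two_le h2]
      refine (ih _ ?_).bracket (ih _ ?_)
      · rw [List.length_take]; omega
      · rw [List.length_drop]; omega
    · rcases l with _ | ⟨a, _ | ⟨b, t⟩⟩
      · exact h0
      · rw [lyndonPi]; exact isPrim_piOne [a]
      · simp at h2

theorem lyndonPi_isHomog_hasLead (n : ℕ) : ∀ l : Word, l.length ≤ n → IsLyndon l →
    IsHomog (ser (lyndonPi k l)) (weight l) ∧ HasLead (ser (lyndonPi k l)) l := by
  induction n with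
  | zero =>
    intro l hl h
    exact absurd (List.length_eq_zero_iff.1 (Nat.le_zero.1 hl)) h.1
  | succ n ih =>
    intro l hl h
    by_cases h2 : 2 ≤ l.length
    · obtain ⟨h3, h4, h5⟩ := stdCut_spec l h2
      have hs := ih (l.take (stdCut l h2)) (by rw [List.length_take]; omega)
        (isLyndon_take_stdCut h h2)
      have hr := ih (l.drop (stdCut l h2)) (by rw [List.length_drop]; omega) h5
      have hlt : WordLT l (l.drop (stdCut l h2)) := h.2 _ h3 h4
      rw [ser_lyndonPi_of_two_le h2]
      set s := l.take (stdCut l h2)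
      set r := l.drop (stdCut l h2)
      have hl : l = s ++ r := (List.take_append_drop _ l).symm
      constructor
      · rw [hl, weight_append]
        refine (hs.1.mul hr.1).sub ?_
        rw [add_comm]
        exact hr.1.mul hs.1
      · rw [hl] at hlt ⊢
        refine (hs.2.mul hr.2).sub (hr.2.mul hs.2) (Or.inr ⟨?_, ?_⟩)
        · simp only [List.length_append]; omega
        -- From `s r < r` and `|r| ≤ |s r|` the comparison is decided at a letter, hence `s r < r
        -- s`: the leading word of the bracket is `s r`.
        · simpa using hlt.append_of_length_le (by simp) [] s
    · rcases l with _ | ⟨a, _ | ⟨b, t⟩⟩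
      · exact absurd rfl h.1
      · rw [lyndonPi]; exact ⟨isHomog_piOne [a], hasLead_piOne a⟩
      · simp at h2

variable (k) in
/-- The series attached to a Lyndon word. -/
def piS (l : Word) : NCSeries k := ser (lyndonPi k l)

theorem isPrim_piS (l : Word) : IsPrim k (piS k l) := isPrim_lyndonPi _ l le_rfl

theorem ser_PiB {L : List Word} {w : Word} (h : IsLyndonFactorization L w) :
    ser (PiB k w) = (L.map (piS k)).prod := by
  have hex : ∃ L, IsLyndonFactorization L w := ⟨L, h⟩
  rw [PiB, dif_pos hex, hex.choose_spec.unique h, ser_list_prod, List.map_map]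
  rfl

theorem piS_prod_isHomog_hasLead {L : List Word} (h : ∀ l ∈ L, IsLyndon l) :
    IsHomog (L.map (piS k)).prod (weight L.flatten) ∧ HasLead (L.map (piS k)).prod L.flatten := by
  induction L with
  | nil => exact ⟨isHomog_one, hasLead_one⟩
  | cons l L ih =>
    simp only [List.mem_cons, forall_eq_or_imp] at h
    have h1 := lyndonPi_isHomog_hasLead (k := k) _ l le_rfl h.1
    have h2 := ih h.2
    rw [List.map_cons, List.prod_cons, List.flatten_cons, weight_append]
    exact ⟨h1.1.mul h2.1, h1.2.mul h2.2⟩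

theorem isHomog_PiB (w : Word) : IsHomog (ser (PiB k w)) (weight w) := by
  obtain ⟨L, hL⟩ := exists_lyndonFactorization w
  rw [ser_PiB hL]
  have := (piS_prod_isHomog_hasLead (k := k) hL.1).1
  rwa [hL.2.2] at this

theorem hasLead_PiB (w : Word) : HasLead (ser (PiB k w)) w := by
  obtain ⟨L, hL⟩ := exists_lyndonFactorization w
  rw [ser_PiB hL]
  have := (piS_prod_isHomog_hasLead (k := k) hL.1).2
  rwa [hL.2.2] at this

end

/-! ### The dual family -/

section

variable {k : Type*} [CommRing k] [Algebra ℚ k]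

/-- Inversion of a unitriangular matrix, by strong induction on the number of words of the same
weight that precede `v`. -/
theorem exists_evalS_PiB_eq (n : ℕ) : ∀ v : Word, (∃ F : Finset Word, F.card ≤ n ∧
    ∀ u, u ∈ F ↔ weight u = weight v ∧ Prec u v) →
    ∃ x : QSym k, ∀ u, evalS k (ser (PiB k u)) x = if u = v then 1 else 0 := by
  classical
  induction n using Nat.strong_induction_on with
  | _ n ih =>
    rintro v ⟨F, hF, hmem⟩
    have h : ∀ u, ∃ x : QSym k, u ∈ F →
        ∀ t, evalS k (ser (PiB k t)) x = if t = u then 1 else 0 := by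
      intro u
      by_cases hu : u ∈ F
      · have hu' := (hmem u).1 hu
        have hlt : (F.filter fun t => weight t = weight u ∧ Prec t u).card < F.card :=
          Finset.card_lt_card (Finset.filter_ssubset.2 ⟨u, hu, fun h => prec_irrefl u h.2⟩)
        obtain ⟨x, hx⟩ := ih _ (hlt.trans_le hF) u ⟨_, le_rfl, fun t => by
          rw [Finset.mem_filter, hmem]
          exact ⟨fun h => h.2, fun h => ⟨⟨h.1.trans hu'.1, h.2.trans hu'.2⟩, h⟩⟩⟩
        exact ⟨x, fun _ => hx⟩
      · exact ⟨0, fun h => absurd h hu⟩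
    choose s hs using h
    -- On `M k v`, only the `Π_u` with `u = v` or `u` in `F` can be nonzero; the dual elements of
    -- the words of `F` correct the latter.
    refine ⟨M k v - ∑ u ∈ F, ser (PiB k u) v • s u, fun t => ?_⟩
    have hsum : ∑ u ∈ F, ser (PiB k u) v • evalS k (ser (PiB k t)) (s u) =
        if t ∈ F then ser (PiB k t) v else 0 := by
      rw [← Finset.sum_ite_eq F t fun u => ser (PiB k u) v]
      refine Finset.sum_congr rfl fun u hu => ?_
      rw [hs u hu]
      split_ifs <;> simp
    rw [map_sub, map_sum, evalS_M]
    simp only [map_smul]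
    rw [hsum]
    split_ifs with h1 h2 h2
    · subst h2
      exact absurd ((hmem t).1 h1).2 (prec_irrefl t)
    · rw [sub_self]
    · rw [h2, (hasLead_PiB v).1, sub_zero]
    · rw [sub_zero]
      by_cases hw : weight t = weight v
      · rcases prec_trichotomy t v with h | h | h
        · exact absurd ((hmem t).2 ⟨hw, h⟩) h1
        · exact absurd h h2
        · exact (hasLead_PiB t).2 v h
      · exact isHomog_PiB t v (Ne.symm hw)

theorem exists_max_prec (s : Finset Word) (hs : s.Nonempty) :
    ∃ m ∈ s, ∀ w ∈ s, w ≠ m → Prec w m := by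
  obtain ⟨m, hm, h⟩ := s.exists_max_image
    (fun w => (toLex (w.length, w) : ℕ ×ₗ List ℕ+ᵒᵈ)) hs
  refine ⟨m, hm, fun w hw hne => ?_⟩
  rcases prec_trichotomy w m with h1 | h1 | h1
  · exact h1
  · exact absurd h1 hne
  · exact absurd (h w hw) (not_le.2 (Prod.Lex.lt_iff.2 h1))

/-- If `m` is the greatest word in the support of `x`, then `Π_m` vanishes on all the other words of
the support and reads off the coefficient of `M k m`. -/
theorem eq_zero_of_evalS_PiB {x : QSym k} (h : ∀ u, evalS k (ser (PiB k u)) x = 0) : x = 0 := by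
  by_contra hx
  have hne : (Finsupp.support (x : Word →₀ k)).Nonempty := Finsupp.support_nonempty_iff.2 hx
  obtain ⟨m, hm, hmax⟩ := exists_max_prec _ hne
  have h1 := h m
  rw [eq_sum_coord x, map_sum, Finset.sum_eq_single m] at h1
  · rw [map_smul, evalS_M, (hasLead_PiB m).1, smul_eq_mul, mul_one] at h1
    exact Finsupp.mem_support_iff.1 hm h1
  · intro w hw hwm
    rw [map_smul, evalS_M, (hasLead_PiB m).2 w (hmax w hw hwm), smul_zero]
  · intro h'
    exact absurd hm h'

theorem eq_of_evalS_PiB {x y : QSym k}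
    (h : ∀ u, evalS k (ser (PiB k u)) x = evalS k (ser (PiB k u)) y) : x = y :=
  sub_eq_zero.1 (eq_zero_of_evalS_PiB fun u => by rw [map_sub, h, sub_self])

variable (k) in
theorem existsUnique_isDualToPi : ∃! s : Word → NCPoly k, IsDualToPi k s := by
  classical
  have h : ∀ v, ∃ P : NCPoly k, ∀ u,
      evalS k (ser (PiB k u)) (toQSym k P) = if u = v then 1 else 0 := by
    intro v
    obtain ⟨x, hx⟩ := exists_evalS_PiB_eq (k := k) _ v
      ⟨(wordsOfWeightLE (weight v)).filter fun u => weight u = weight v ∧ Prec u v, le_rfl,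
        fun u => by
          rw [Finset.mem_filter, mem_wordsOfWeightLE]
          exact ⟨fun h => h.2, fun h => ⟨h.1.le, h⟩⟩⟩
    obtain ⟨P, rfl⟩ := toQSym_surjective x
    exact ⟨P, hx⟩
  choose s hs using h
  refine ⟨s, fun u v => by rw [pairing_eq, hs], fun t ht => funext fun v => ?_⟩
  refine toQSym_injective (eq_of_evalS_PiB fun u => ?_)
  rw [hs, ← pairing_eq, ht]

variable (k) in
/-- The dual family, as quasi-symmetric functions. -/
def sigmaQ (v : Word) : QSym k := toQSym k (SigmaB k v)

theorem evalS_PiB_sigmaQ (u v : Word) :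
    evalS k (ser (PiB k u)) (sigmaQ k v) = if u = v then 1 else 0 := by
  have hex : ∃ s, IsDualToPi k s := (existsUnique_isDualToPi k).exists
  rw [sigmaQ, ← pairing_eq, SigmaB, dif_pos hex]
  exact hex.choose_spec u v

/-! ### Products of the dual family -/

theorem evalS_piS_cons (a : Word) (L : List Word) (x : QSym k) :
    evalS k ((a :: L).map (piS k)).prod x = evalS k (L.map (piS k)).prod (lderiv (piS k a) x) := by
  rw [List.map_cons, List.prod_cons, evalS_mul]

theorem evalS_piS_cons_mul (a : Word) (L : List Word) (x y : QSym k) :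
    evalS k ((a :: L).map (piS k)).prod (x * y) =
      evalS k (L.map (piS k)).prod (lderiv (piS k a) x * y)
        + evalS k (L.map (piS k)).prod (x * lderiv (piS k a) y) := by
  rw [evalS_piS_cons, (isPrim_piS a).lderiv_mul, map_add]

/-- By the Leibniz rule, a product of primitive elements acts on `z * x` through all splittings of
the list into a part acting on `z` and a part acting on `x`. Here only the empty part on `z`
survives. -/
theorem evalS_piS_mul_of_sublist (L : List Word) : ∀ z x : QSym k,
    (∀ V : List Word, V.Sublist L → V ≠ [] → evalS k (V.map (piS k)).prod z = 0) →
    evalS k (L.map (piS k)).prod (z * x) =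
      evalS k (1 : NCSeries k) z * evalS k (L.map (piS k)).prod x := by
  induction L with
  | nil =>
    intro z x _
    exact evalS_one_mul z x
  | cons a L ih =>
    intro z x h
    have h0 : evalS k (1 : NCSeries k) (lderiv (piS k a) z) = 0 := by
      have := h [a] (by simp) (by simp)
      rw [evalS_piS_cons] at this
      exact this
    rw [evalS_piS_cons_mul, ih (lderiv (piS k a) z), h0, ih z, zero_mul, zero_add, evalS_piS_cons]
    · exact fun V hV hne => h V (hV.cons a) hne
    · intro V hV _
      rw [← evalS_piS_cons]
      exact h _ (hV.cons_cons a) (by simp)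

theorem cons_erase_of_max {l : Word} {L : List Word} (hL : L.Pairwise fun x y => ¬ WordLT x y)
    (hmax : ∀ x ∈ L, ¬ WordLT l x) (hl : l ∈ L) : l :: L.erase l = L := by
  cases L with
  | nil => simp at hl
  | cons m L =>
    have h1 : l = m := by
      rcases List.mem_cons.1 hl with h | h
      · exact h
      · have h2 := (List.pairwise_cons.1 hL).1 l h
        have h3 := hmax m (by simp)
        rcases wordLT_trichotomy l m with h4 | h4 | h4
        · exact absurd h4 h3
        · exact h4
        · exact absurd h4 h2
    subst h1
    rw [List.erase_cons_head]

/-- In the same Leibniz expansion, exactly one copy of `l` must act on `z`. The list being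
nonincreasing, its copies of `l` are adjacent, so each choice leaves the same list. -/
theorem evalS_piS_mul_of_dual (l : Word) (L : List Word) : ∀ z x : QSym k,
    (L.Pairwise fun x y => ¬ WordLT x y) →
    (∀ V : List Word, V.Sublist L →
      evalS k (V.map (piS k)).prod z = if V = [l] then 1 else 0) →
    evalS k (L.map (piS k)).prod (z * x) =
      L.count l * evalS k ((L.erase l).map (piS k)).prod x := by
  induction L with
  | nil =>
    intro z x _ h
    have h0 := h [] List.Sublist.slnil
    rw [if_neg (by simp)] at h0
    have h1 : evalS k (1 : NCSeries k) z = 0 := h0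
    change evalS k (1 : NCSeries k) (z * x) = _
    rw [evalS_one_mul, h1]
    simp
  | cons a L ih =>
    intro z x hL h
    rw [List.pairwise_cons] at hL
    have h1 : evalS k (1 : NCSeries k) (lderiv (piS k a) z) = if a = l then 1 else 0 := by
      have := h [a] (by simp)
      rw [evalS_piS_cons] at this
      simpa using this
    rw [evalS_piS_cons_mul, evalS_piS_mul_of_sublist L (lderiv (piS k a) z), h1,
      ih z _ hL.2 fun V hV => h V (hV.cons a), ← evalS_piS_cons]
    · by_cases hal : a = l
      · subst hal
        rw [if_pos rfl, List.count_cons_self, List.erase_cons_head, one_mul]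
        -- If `a` occurs again in the tail, the tail starts with `a`, and erasing the first or a
        -- later copy gives the same list.
        by_cases ha : a ∈ L
        · rw [cons_erase_of_max hL.2 hL.1 ha]
          push_cast
          ring
        · simp [List.count_eq_zero_of_not_mem ha]
      · rw [if_neg hal, zero_mul, zero_add, List.count_cons_of_ne hal,
          List.erase_cons_tail (by simpa using hal)]
    · intro V hV hne
      rw [← evalS_piS_cons, h _ (hV.cons_cons a), if_neg]
      simpa using fun _ => hne

/-- Nonincreasing lists of Lyndon words. -/
def IsLyndonList (L : List Word) : Prop := IsLyndonFactorization L L.flatten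

theorem IsLyndonList.sublist {L K : List Word} (h : IsLyndonList L) (hK : K.Sublist L) :
    IsLyndonList K := IsLyndonFactorization.sublist h hK

theorem evalS_piS_sigmaQ {L : List Word} {l : Word} (hL : IsLyndonList L) (hl : IsLyndon l) :
    evalS k (L.map (piS k)).prod (sigmaQ k l) = if L = [l] then 1 else 0 := by
  rw [← ser_PiB hL, evalS_PiB_sigmaQ]
  refine if_congr ⟨fun h => ?_, fun h => ?_⟩ rfl rfl
  · unfold IsLyndonList at hL
    rw [h] at hL
    exact hL.unique hl.factorization
  · rw [h]; simp

/-- Erasing `n` occurrences of a word. -/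
def eraseN (l : Word) (n : ℕ) (L : List Word) : List Word := (fun V => V.erase l)^[n] L

theorem eraseN_succ (l : Word) (n : ℕ) (L : List Word) :
    eraseN l (n + 1) L = eraseN l n (L.erase l) := rfl

theorem eraseN_sublist (l : Word) (n : ℕ) : ∀ L, (eraseN l n L).Sublist L := by
  induction n with
  | zero => exact fun L => List.Sublist.refl L
  | succ n ih => exact fun L => (ih _).trans List.erase_sublist

theorem mem_eraseN_of_ne {l u : Word} (h : u ≠ l) (n : ℕ) : ∀ {L}, u ∈ L → u ∈ eraseN l n L := by
  induction n with
  | zero => exact fun hu => hu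
  | succ n ih => exact fun hu => ih ((List.mem_erase_of_ne h).2 hu)

theorem count_eraseN (l : Word) (n : ℕ) : ∀ L, (eraseN l n L).count l = L.count l - n := by
  induction n with
  | zero => exact fun L => rfl
  | succ n ih =>
    intro L
    rw [eraseN_succ, ih, List.count_erase_self]
    omega

/-- Each factor `Σ_l` consumes one of the remaining copies of `l`, whose numbers multiply to a
descending factorial. It is zero when the copies run out, so the value of `eraseN` there is
harmless. -/
theorem evalS_piS_sigmaQ_pow_mul {l : Word} (hl : IsLyndon l) (n : ℕ) : ∀ (L : List Word)
    (x : QSym k), IsLyndonList L → evalS k (L.map (piS k)).prod (sigmaQ k l ^ n * x) =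
      ((L.count l).descFactorial n : k) * evalS k ((eraseN l n L).map (piS k)).prod x := by
  induction n with
  | zero => intro L x _; simp [eraseN]
  | succ n ih =>
    intro L x hL
    rw [pow_succ', mul_assoc, evalS_piS_mul_of_dual l L _ _ hL.2.1
      fun V hV => evalS_piS_sigmaQ (hL.sublist hV) hl,
      ih _ _ (hL.sublist List.erase_sublist), eraseN_succ, List.count_erase_self, ← mul_assoc]
    congr 1
    cases L.count l with
    | zero => simp
    | succ c => rw [Nat.succ_descFactorial_succ, Nat.add_sub_cancel]; push_cast; ring

theorem piS_prod_eq_pow_mul {l : Word} (n : ℕ) : ∀ {L : List Word},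
    (L.Pairwise fun x y => ¬ WordLT x y) → (∀ x ∈ L, ¬ WordLT l x) → n ≤ L.count l →
    (L.map (piS k)).prod = piS k l ^ n * ((eraseN l n L).map (piS k)).prod := by
  induction n with
  | zero => intro L _ _ _; rw [pow_zero, one_mul]; rfl
  | succ n ih =>
    intro L hL hmax hn
    have hl : l ∈ L := List.count_pos_iff.1 (by omega)
    rw [eraseN_succ, pow_succ', mul_assoc, ← ih (hL.sublist List.erase_sublist)
      (fun x hx => hmax x (List.mem_of_mem_erase hx)) (by rw [List.count_erase_self]; omega)]
    conv_lhs => rw [← cons_erase_of_max hL hmax hl]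
    rw [List.map_cons, List.prod_cons]

theorem piS_nil (l : Word) : piS k l [] = 0 := by
  -- Primitivity at `1 * 1` says that the constant term equals its own double.
  have := isPrim_piS (k := k) l [] []
  rw [M_nil, one_mul, ← M_nil, evalS_M] at this
  simpa [NCSeries.one_apply] using this

/-! ### The factorization of the generating series -/

variable (k) in
/-- The factor attached to a Lyndon word. -/
def expFactor (l : Word) : NCSeries (QSym k) :=
  NCSeries.exp (scaled k (toQSym k (SigmaB k l)) (PiB k l))

theorem scaled_pow_apply {l : Word} (hl : IsLyndon l) (n : ℕ) : ∀ v : Word,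
    (scaled k (toQSym k (SigmaB k l)) (PiB k l) ^ n) v = (piS k l ^ n) v • sigmaQ k l ^ n := by
  have h1 : ∀ v, scaled k (toQSym k (SigmaB k l)) (PiB k l) v = piS k l v • sigmaQ k l := by
    intro v
    have : ser (PiB k l) = piS k l := by
      rw [ser_PiB hl.factorization]
      simp
    rw [← this]
    rfl
  induction n with
  | zero =>
    intro v
    simp only [pow_zero, NCSeries.one_apply]
    split_ifs <;> simp
  | succ n ih =>
    intro v
    rw [pow_succ', pow_succ', NCSeries.mul_apply, NCSeries.mul_apply, Finset.sum_smul]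
    refine Finset.sum_congr rfl fun i _ => ?_
    rw [h1, ih, smul_mul_smul_comm, pow_succ']

theorem expFactor_apply {l : Word} (hl : IsLyndon l) (v : Word) {N : ℕ} (hN : v.length ≤ N) :
    expFactor k l v = ∑ n ∈ Finset.range (N + 1),
      (1 / (n.factorial : ℚ)) • (piS k l ^ n) v • sigmaQ k l ^ n := by
  rw [expFactor, NCSeries.exp]
  simp only [scaled_pow_apply hl]
  refine Finset.sum_subset (Finset.range_mono (by omega)) fun n _ hn => ?_
  rw [NCSeries.pow_apply_eq_zero _ (piS_nil l), zero_smul, smul_zero]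
  simpa using hn

/-- The factor `1 / n!` of the exponential turns the descending factorial of
`evalS_piS_sigmaQ_pow_mul` into a binomial coefficient. The bound `N` is free so that the range can
be enlarged. -/
theorem evalS_expFactor_mul {l : Word} (hl : IsLyndon l) (P : NCSeries (QSym k)) {U : List Word}
    (hU : IsLyndonList U) (w : Word) {N : ℕ} (hN : w.length ≤ N) :
    evalS k (U.map (piS k)).prod ((expFactor k l * P) w) =
      ∑ n ∈ Finset.range (N + 1), ((U.count l).choose n : k) *
        (piS k l ^ n * P.map (evalS k ((eraseN l n U).map (piS k)).prod)) w := by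
  have hc : ∀ (c n : ℕ) (a b : k), (1 / (n.factorial : ℚ)) • (a * ((c.descFactorial n : k) * b))
      = (c.choose n : k) * (a * b) := by
    intro c n a b
    have h1 : (c.descFactorial n : k) = algebraMap ℚ k (n.factorial * c.choose n) := by
      rw [Nat.descFactorial_eq_factorial_mul_choose]
      simp
    have h2 : algebraMap ℚ k (1 / (n.factorial : ℚ)) * algebraMap ℚ k (n.factorial * c.choose n)
        = (c.choose n : k) := by
      rw [← map_mul, ← mul_assoc, one_div, inv_mul_cancel₀ (by positivity), one_mul]
      simp
    rw [Algebra.smul_def, h1, ← h2]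
    ring
  have e : ∀ i ∈ Finset.range (w.length + 1),
      evalS k (U.map (piS k)).prod (expFactor k l (w.take i) * P (w.drop i)) =
      ∑ n ∈ Finset.range (N + 1), ((U.count l).choose n : k) * ((piS k l ^ n) (w.take i) *
        evalS k ((eraseN l n U).map (piS k)).prod (P (w.drop i))) := by
    intro i _
    rw [expFactor_apply hl (w.take i) (N := N) (by rw [List.length_take]; omega), Finset.sum_mul,
      map_sum]
    refine Finset.sum_congr rfl fun n _ => ?_
    rw [smul_mul_assoc, smul_mul_assoc, map_rat_smul, map_smul,
      evalS_piS_sigmaQ_pow_mul hl n U _ hU, smul_eq_mul, hc]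
  rw [NCSeries.mul_apply, map_sum, Finset.sum_congr rfl e, Finset.sum_comm]
  refine Finset.sum_congr rfl fun n _ => ?_
  rw [NCSeries.mul_apply, Finset.mul_sum]
  rfl

open Classical in
-- The largest word `l` of the list is peeled off. If `l` has `c` copies in `U`, then taking `n < c`
-- of them leaves a copy of `l` for the remaining factors, which do not involve `l`, and `n > c` has
-- zero binomial coefficient. The term `n = c` rebuilds the product, since `l` dominates `U` and its
-- copies come first.
theorem evalS_prod_expFactor (Ls : List Word) : (∀ l ∈ Ls, IsLyndon l) →
    (Ls.Pairwise fun l l' => WordLT l' l) → ∀ (U : List Word), IsLyndonList U → ∀ w : Word,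
    evalS k (U.map (piS k)).prod ((Ls.map (expFactor k)).prod w) =
      if ∀ u ∈ U, u ∈ Ls then (U.map (piS k)).prod w else 0 := by
  induction Ls with
  | nil =>
    intro _ _ U hU w
    have h1 : (([] : List Word).map (expFactor k)).prod w = if w = [] then M k [] else 0 := rfl
    rw [h1]
    by_cases hw : w = []
    · subst hw
      rw [if_pos rfl, evalS_M]
      cases U with
      | nil => rw [if_pos fun _ h => h]
      | cons u U =>
        rw [List.map_cons, List.prod_cons, NCSeries.mul_nil, piS_nil, zero_mul, ite_self]
    · rw [if_neg hw, map_zero]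
      cases U with
      | nil =>
        rw [if_pos fun _ h => h]
        exact (if_neg hw).symm
      | cons u U => rw [if_neg fun h => by simpa using h u]
  | cons l Ls ih =>
    intro hLs hdec U hU w
    simp only [List.mem_cons, forall_eq_or_imp] at hLs
    rw [List.pairwise_cons] at hdec
    have hlLs : l ∉ Ls := fun h => wordLT_irrefl l (hdec.1 l h)
    rw [List.map_cons, List.prod_cons,
      -- The summand `U.count l` in the bound guarantees that the surviving index lies in the range.
      evalS_expFactor_mul hLs.1 _ hU w (N := w.length + U.count l) (by omega)]
    have e : ∀ n, ((Ls.map (expFactor k)).prod.map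
        (evalS k ((eraseN l n U).map (piS k)).prod) : NCSeries k) =
        if ∀ u ∈ eraseN l n U, u ∈ Ls then ((eraseN l n U).map (piS k)).prod else 0 := by
      intro n
      funext v
      have := ih hLs.2 hdec.2 _ (hU.sublist (eraseN_sublist l n U)) v
      rw [NCSeries.map, this]
      split_ifs <;> rfl
    simp only [e]
    by_cases hsub : ∀ u ∈ U, u ∈ l :: Ls
    · have hmax : ∀ u ∈ U, ¬ WordLT l u := by
        intro u hu
        rcases List.mem_cons.1 (hsub u hu) with h | h
        · rw [h]; exact wordLT_irrefl l
        · exact (hdec.1 u h).asymm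
      rw [if_pos hsub, Finset.sum_eq_single (U.count l)]
      · rw [if_pos, ← piS_prod_eq_pow_mul _ hU.2.1 hmax le_rfl, Nat.choose_self, Nat.cast_one,
          one_mul]
        intro u hu
        refine (List.mem_cons.1 (hsub u ((eraseN_sublist l _ U).subset hu))).resolve_left ?_
        rintro rfl
        have h1 := count_eraseN u (U.count u) U
        rw [Nat.sub_self, List.count_eq_zero] at h1
        exact h1 hu
      · intro n _ hn
        rcases lt_or_gt_of_ne hn with h | h
        · rw [if_neg, mul_zero]
          · change _ * (0 : k) = 0
            rw [mul_zero]
          · intro h1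
            refine hlLs (h1 l ?_)
            rw [← List.count_pos_iff, count_eraseN]
            omega
        · rw [Nat.choose_eq_zero_of_lt h, Nat.cast_zero, zero_mul]
      · intro h
        simp at h
    · rw [if_neg hsub]
      push Not at hsub
      obtain ⟨u, hu, hul⟩ := hsub
      rw [List.mem_cons, not_or] at hul
      refine Finset.sum_eq_zero fun n _ => ?_
      rw [if_neg fun h => hul.2 (h u (mem_eraseN_of_ne hul.1 n hu)), mul_zero]
      change _ * (0 : k) = 0
      rw [mul_zero]

theorem weight_le_of_mem {u : Word} {U : List Word} (h : u ∈ U) :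
    weight u ≤ weight U.flatten := by
  induction U with
  | nil => simp at h
  | cons v U ih =>
    rw [List.flatten_cons, weight_append]
    rcases List.mem_cons.1 h with rfl | h
    · omega
    · have := ih h
      omega

variable (k) in
-- The coefficients of `w` are compared through every `Π_u`. Once the list contains all Lyndon words
-- of weight at most `weight w`, a factor of `u` missing from it is too heavy: then `u` and `w` have
-- different weights and `Π_u` has no term in `w`.
theorem isDecreasingLyndonProd_genM :
    NCSeries.IsDecreasingLyndonProd (expFactor k) (genM k) := by
  classical
  intro w
  refine ⟨(wordsOfWeightLE (weight w)).filter IsLyndon, fun l hl => (Finset.mem_filter.1 hl).2,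
    fun L hL hdec hF => eq_of_evalS_PiB fun u => ?_⟩
  obtain ⟨U, hU⟩ := exists_lyndonFactorization u
  have hU' : IsLyndonList U := ⟨hU.1, hU.2.1, rfl⟩
  rw [genM_apply, evalS_M, ser_PiB hU, evalS_prod_expFactor L hL hdec U hU']
  split_ifs with h
  · rfl
  · push Not at h
    obtain ⟨v, hv, hvL⟩ := h
    rw [← ser_PiB hU, isHomog_PiB u]
    intro hw
    refine hvL (hF v (Finset.mem_filter.2 ⟨mem_wordsOfWeightLE.2 ?_, hU.1 v hv⟩))
    rw [hw, ← hU.2.2]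
    exact weight_le_of_mem hv

end

end Quasi

end

/-! ### The four statements together -/

theorem mainTheorem8 (k : Type*) [CommRing k] [Algebra ℚ k] :
    Quasi.IsGroupLike k (Quasi.genM k) ∧
    Quasi.IsPrimitive k (Quasi.NCSeries.log (Quasi.genM k)) ∧
    ((∃! s : Quasi.Word → Quasi.NCPoly k, Quasi.IsDualToPi k s) ∧
      Quasi.NCSeries.IsDecreasingLyndonProd
        (fun l => Quasi.NCSeries.exp
          (Quasi.scaled k (Quasi.toQSym k (Quasi.SigmaB k l)) (Quasi.PiB k l)))
        (Quasi.genM k)) ∧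
    Quasi.NCSeries.IsSum
      (fun w => Quasi.scaled k (Quasi.toQSym k (Quasi.word k w)) (Quasi.piOne k w))
      (Quasi.NCSeries.log (Quasi.genM k)) :=
  ⟨Quasi.isGroupLike_genM, Quasi.isPrimitive_log_genM k,
    ⟨Quasi.existsUnique_isDualToPi k, Quasi.isDecreasingLyndonProd_genM k⟩,
    Quasi.isSum_log_genM⟩
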